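/- Let $T>0$ and $\delta\in[0,1]$. Let $\eta\in C^1([0,T];(0,\infty))$, let $\kappa\in C^1([0,T])$ with $\kappa\ge 0$, and let $\lambda\in L^\infty([0,T])$ with $\lambda\ge 0$ and $\lambda+\delta\dot\kappa\ge 0$ almost everywhere. Let $\nu_0$ be a probability measure on $\mathbb R$ with finite first absolute moment and $\nu_0(\{0\})=0$. Put $p_0(x)=\nu_0((-\infty,x])$ and $q_0(x)=\nu_0([x,\infty))$. Let $A=A^\delta$ be the (unique) solution on $[0,T)$ of $-\dot A_t=-\frac{A_t^2}{\eta_t}+\delta\frac{\kappa_t}{\eta_t}A_t+\lambda_t$ with $\lim_{t\nearrow T}A_t=\infty$, and let $$h_t=e^{-\int_0^t\frac{A_r}{\eta_r}dr}\int_0^t\frac1{\eta_s}e^{\int_0^s\frac{2A_r-\delta\kappa_r}{\eta_r}dr}ds .$$ For $\mu\in L^1([0,T])$ put $f_\mu(t)=\int_0^t\kappa_u\mu_uh_u\,du$, $\overline f_\mu(t)=\max_{0\le s\le t}f_\mu(s)$ and $\underline f_\mu(t)=\min_{0\le s\le t}f_\mu(s)$. For $x\in\mathbb R$ put $\tau_\mu(x)=\inf\{t\in[0,T]:f_\mu(t)=x\}$,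 where $\inf\emptyset=T$. For $x\neq0$ let $(X^{\delta,x,\mu},Y^{\delta,x,\mu})$ be the (unique) pair of absolutely continuous functions on $[0,T]$ with $$\dot X_t=-\frac{Y_t-\delta\kappa_tX_t}{\eta_t}1_{\{t\le\tau_\mu(x)\}},\qquad -\dot Y_t=(\lambda_tX_t+\kappa_t\mu_t)1_{\{t\le\tau_\mu(x)\}}\quad\text{for a.e. }t\in[0,T],\qquad X_0=x,\ X_T=0,$$ and let $\xi^{\delta,x,\mu}=(Y^{\delta,x,\mu}-\delta\kappa X^{\delta,x,\mu})/\eta$ and $F(\mu)_t=\int_{\mathbb R}\xi^{\delta,x,\mu}_t\,\nu_0(dx)$ for $t\in[0,T]$. Let $\mu:[0,T]\to\mathbb R$ be integrable. Then $x\mapsto\xi^{\delta,x,\mu}_t$ is $\nu_0$-integrable for every $t\in[0,T]$, so $F(\mu)$ is well defined, and $\mu$ solves the fixed-point equation $\mu_t=F(\mu)_t$ for all $t\in[0,T]$ if and only if $\mu_T=F(\mu)_T$ and, for all $t\in[0,T]$, $$\mu_t=\mu_T+\int_t^T\frac{\kappa_s}{\eta_s}\Big(q_0\big(\overline f_\mu(s)\big)+p_0\big(\underline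 f_\mu(s)\big)\Big)\mu_s\,ds+\int_t^T\frac{\lambda_s+\delta\dot\kappa_s}{\eta_s}\Big(\int_s^T\mu_u\,du\Big)ds+\int_t^T\frac{\dot\eta_s-\delta\kappa_s}{\eta_s}\mu_s\,ds .$$ -/

import Mathlib

open Set Filter Topology MeasureTheory

noncomputable section

namespace LiquidationGame

/-- Raw data of the liquidation game: the horizon `T`, the parameter `δ` (`δ = 0` for the mean
field game, `δ = 1/N` for the game with `N` players) and the cost coefficients `η`, `κ`, `lam`
(the risk coefficient), which are only evaluated on `[0, T]`. -/
structure Coefficients where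
  T : ℝ
  δ : ℝ
  η : ℝ → ℝ
  κ : ℝ → ℝ
  lam : ℝ → ℝ

namespace Coefficients

/-- The derivative of `κ` on `[0, T]` (one-sided at the endpoints). -/
def κ' (P : Coefficients) (t : ℝ) : ℝ := derivWithin P.κ (Icc 0 P.T) t

/-- The derivative of `η` on `[0, T]` (one-sided at the endpoints). -/
def η' (P : Coefficients) (t : ℝ) : ℝ := derivWithin P.η (Icc 0 P.T) t

end Coefficients

variable (P : Coefficients)

/-- `A` solves the singular terminal value problem
`-A' = -A² / η + δ (κ / η) A + lam` on `[0, T)`, `A t → ∞` as `t ↗ T`.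
As `lam` is only bounded and measurable, the equation is meant for almost every `t` and `A` is
locally absolutely continuous on `[0, T)`; this is the integrated form. -/
structure IsRiccatiSolution (A : ℝ → ℝ) : Prop where
  continuousOn : ContinuousOn A (Ico 0 P.T)
  eq : ∀ t ∈ Ico 0 P.T,
    A t = A 0 + ∫ s in (0 : ℝ)..t,
      ((A s) ^ 2 / P.η s - P.δ * (P.κ s / P.η s) * A s - P.lam s)
  tendsto : Tendsto A (𝓝[<] P.T) atTop

/-- The process `A^δ`: the solution of the singular terminal value problem. -/
def riccati : ℝ → ℝ := Classical.epsilon (IsRiccatiSolution P)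

/-- `h^δ_t = exp(-∫₀ᵗ A/η) ∫₀ᵗ (1/η_s) exp(∫₀ˢ (2A - δκ)/η) ds`. -/
def h (t : ℝ) : ℝ :=
  Real.exp (-∫ r in (0 : ℝ)..t, riccati P r / P.η r) *
    ∫ s in (0 : ℝ)..t, (1 / P.η s) *
      Real.exp (∫ r in (0 : ℝ)..s, (2 * riccati P r - P.δ * P.κ r) / P.η r)

/-- `f_μ(t) = ∫₀ᵗ κ μ h^δ`. -/
def f (μ : ℝ → ℝ) (t : ℝ) : ℝ := ∫ u in (0 : ℝ)..t, P.κ u * μ u * h P u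

/-- The running maximum of `f_μ` (attained, as `f_μ` is continuous). -/
def fMax (μ : ℝ → ℝ) (t : ℝ) : ℝ := sSup (f P μ '' Icc 0 t)

/-- The running minimum of `f_μ`. -/
def fMin (μ : ℝ → ℝ) (t : ℝ) : ℝ := sInf (f P μ '' Icc 0 t)

/-- The candidate liquidation time `τ_μ(x) = inf {t ∈ [0, T] : f_μ(t) = x}`, with the convention
`inf ∅ = T`: inserting `T` into the set implements this convention and changes nothing else. -/
def τ (μ : ℝ → ℝ) (x : ℝ) : ℝ := sInf (insert P.T {t ∈ Icc 0 P.T | f P μ t = x})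

/-- `(X, Y)` is a continuous solution of the forward-backward system
`X' = -((Y - δ κ X) / η) 1_{t ≤ τ_μ(x)}`, `-Y' = (lam X + κ μ) 1_{t ≤ τ_μ(x)}` a.e. on `[0, T]`,
`X_0 = x`, `X_T = 0`, in integrated form. -/
structure IsForwardBackwardSolution (μ : ℝ → ℝ) (x : ℝ) (X Y : ℝ → ℝ) : Prop where
  continuousOn_X : ContinuousOn X (Icc 0 P.T)
  continuousOn_Y : ContinuousOn Y (Icc 0 P.T)
  forward : ∀ t ∈ Icc 0 P.T,
    X t = x - ∫ s in (0 : ℝ)..t,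
      if s ≤ τ P μ x then (Y s - P.δ * P.κ s * X s) / P.η s else 0
  backward : ∀ t ∈ Icc 0 P.T,
    Y t = Y P.T + ∫ s in t..P.T,
      if s ≤ τ P μ x then P.lam s * X s + P.κ s * μ s else 0
  terminal : X P.T = 0

/-- The pair `(X^{δ,x,μ}, Y^{δ,x,μ})`: the solution of the forward-backward system. -/
def state (μ : ℝ → ℝ) (x : ℝ) : (ℝ → ℝ) × (ℝ → ℝ) :=
  Classical.epsilon fun p => IsForwardBackwardSolution P μ x p.1 p.2

/-- The candidate strategy `ξ^{δ,x,μ} = (Y^{δ,x,μ} - δ κ X^{δ,x,μ}) / η`. -/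
def ξ (μ : ℝ → ℝ) (x t : ℝ) : ℝ :=
  ((state P μ x).2 t - P.δ * P.κ t * (state P μ x).1 t) / P.η t

/-- `F(μ)_t = ∫ ξ^{δ,x,μ}_t ν₀(dx)`. -/
def F (ν₀ : Measure ℝ) (μ : ℝ → ℝ) (t : ℝ) : ℝ := ∫ x, ξ P μ x t ∂ν₀

/-- `p₀(x) = ν₀((-∞, x])`. -/
def p₀ (ν₀ : Measure ℝ) (x : ℝ) : ℝ := ν₀.real (Iic x)

/-- `q₀(x) = ν₀([x, ∞))`. -/
def q₀ (ν₀ : Measure ℝ) (x : ℝ) : ℝ := ν₀.real (Ici x)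

/-- `μ` solves the fixed-point equation `μ = F(μ)` on `[0, T]`. -/
def SolvesFixedPoint (ν₀ : Measure ℝ) (μ : ℝ → ℝ) : Prop :=
  ∀ t ∈ Icc 0 P.T, μ t = F P ν₀ μ t

/-- `μ` solves the nonlinear higher-order integral equation on `[0, T]`. -/
def SolvesIntegralEquation (ν₀ : Measure ℝ) (μ : ℝ → ℝ) : Prop :=
  ∀ t ∈ Icc 0 P.T,
    μ t = μ P.T
      + (∫ s in t..P.T, P.κ s / P.η s * (q₀ ν₀ (fMax P μ s) + p₀ ν₀ (fMin P μ s)) * μ s)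
      + (∫ s in t..P.T, (P.lam s + P.δ * P.κ' s) / P.η s * ∫ u in s..P.T, μ u)
      + ∫ s in t..P.T, (P.η' s - P.δ * P.κ s) / P.η s * μ s

end LiquidationGame

end

/-! The mean rate `F(μ)` always satisfies a linear backward equation, whether or not `μ` is a fixed
point. Each `ξ^x` satisfies `-ξ' = (κ/η) μ 1_{t ≤ τ(x)} + ((lam + δκ')/η) ∫_t^T ξ + ((η' - δκ)/η)
ξ`, and averaging over `ν₀` gives the same equation for `F(μ)`, with the indicator replaced by the
participation rate `ν₀{x | t ≤ τ(x)}` (`isPrimitiveOn_F`). The claimed equation has `μ` in place of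
`F(μ)` and `q₀(fMax) + p₀(fMin)` in place of the participation rate, so the task is to compare the
two rates.

Since `f_μ` is continuous, `s ≤ τ(x)` means `x ∉ f_μ([0, s))`. The measure of this complement equals
`q₀ + p₀` at the running extrema when `f_μ` is monotone and reaches the value `f_μ(s)` for the first
time at `s`. Monotonicity follows from `κ ≥ 0`, `h ≥ 0` and a constant sign of `μ`. The sign comes
from a Gronwall argument using `lam + δκ' ≥ 0`, valid for either version of the equation
(`sign_trichotomy`). First attainment may fail only where `κ μ = 0`, and there the rate is
irrelevant (`κ_mul_participation_eq`). Hence both versions of the equation for `μ` are equivalent. A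
fixed point satisfies the participation version; conversely, if `μ` satisfies it, `F(μ) - μ` solves
a homogeneous linear equation with zero terminal value and vanishes.

The equation for `ξ^x` rests on the explicit form of the state. With a fundamental system normalised
at `0`, `h = -X₂ exp(-∫ δκ/η)` (`h_eq`), so `x - f_μ(t)` is precisely the coefficient of the first
solution in the variation of constants formula. At a time `τ < T` with `f_μ(τ) = x`, the condition
`X_τ = 0` then forces `Y_τ = 0` too, and the state stays at zero (`state_eq_zero`). The signs of the
fundamental system come from an energy identity. -/

/-! ### Calculus of absolutely continuous functions in integrated form -/

/-- `u` is, on `[0, b]`, a primitive of the integrable function `u'`. -/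
structure IsPrimitiveOn (b : ℝ) (u u' : ℝ → ℝ) : Prop where
  nonneg : 0 ≤ b
  intervalIntegrable : IntervalIntegrable u' volume 0 b
  eq_add_integral : ∀ t ∈ Icc 0 b, u t = u 0 + ∫ s in (0 : ℝ)..t, u' s

namespace IsPrimitiveOn

variable {b : ℝ} {u u' v v' : ℝ → ℝ}

theorem zero_mem (hu : IsPrimitiveOn b u u') : (0 : ℝ) ∈ Icc 0 b := ⟨le_rfl, hu.nonneg⟩

theorem intervalIntegrable_of_mem (hu : IsPrimitiveOn b u u') {s t : ℝ}
    (hs : s ∈ Icc 0 b) (ht : t ∈ Icc 0 b) : IntervalIntegrable u' volume s t :=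
  hu.intervalIntegrable.mono_set <| by
    rw [uIcc_of_le hu.nonneg]
    exact uIcc_subset_Icc hs ht

theorem integral_eq_sub (hu : IsPrimitiveOn b u u') {s t : ℝ}
    (hs : s ∈ Icc 0 b) (ht : t ∈ Icc 0 b) : ∫ r in s..t, u' r = u t - u s := by
  have := intervalIntegral.integral_add_adjacent_intervals
    (hu.intervalIntegrable_of_mem hu.zero_mem hs) (hu.intervalIntegrable_of_mem hs ht)
  rw [hu.eq_add_integral t ht, hu.eq_add_integral s hs]
  linarith

theorem mono (hu : IsPrimitiveOn b u u') {c : ℝ} (hc : c ∈ Icc 0 b) : IsPrimitiveOn c u u' :=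
  ⟨hc.1, hu.intervalIntegrable_of_mem hu.zero_mem hc,
    fun t ht => hu.eq_add_integral t ⟨ht.1, ht.2.trans hc.2⟩⟩

theorem continuousOn (hu : IsPrimitiveOn b u u') : ContinuousOn u (Icc 0 b) := by
  have := intervalIntegral.continuousOn_primitive_interval' hu.intervalIntegrable left_mem_uIcc
  rw [uIcc_of_le hu.nonneg] at this
  exact (continuousOn_const.add this).congr hu.eq_add_integral

theorem congr_ae (hu : IsPrimitiveOn b u u') (h : ∀ t ∈ Icc 0 b, v t = u t)
    (h' : ∀ᵐ t, t ∈ Ioc 0 b → v' t = u' t) : IsPrimitiveOn b v v' := by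
  refine ⟨hu.nonneg, hu.intervalIntegrable.congr_ae ?_, fun t ht => ?_⟩
  · rw [uIoc_of_le hu.nonneg, EventuallyEq, ae_restrict_iff' measurableSet_Ioc]
    filter_upwards [h'] with s hs hst using (hs hst).symm
  · rw [h t ht, h 0 hu.zero_mem, hu.eq_add_integral t ht]
    congr 1
    refine intervalIntegral.integral_congr_ae ?_
    filter_upwards [h'] with s hs hst
    rw [uIoc_of_le ht.1] at hst
    exact (hs ⟨hst.1, hst.2.trans ht.2⟩).symm

theorem congr (hu : IsPrimitiveOn b u u') (h : ∀ t ∈ Icc 0 b, v t = u t)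
    (h' : ∀ t ∈ Icc 0 b, v' t = u' t) : IsPrimitiveOn b v v' :=
  hu.congr_ae h (.of_forall fun t ht => h' t (Ioc_subset_Icc_self ht))

theorem congr_deriv (hu : IsPrimitiveOn b u u') (h' : ∀ t ∈ Icc 0 b, v' t = u' t) :
    IsPrimitiveOn b u v' :=
  hu.congr (fun _ _ => rfl) h'

theorem const (hb : 0 ≤ b) (c : ℝ) : IsPrimitiveOn b (fun _ => c) (fun _ => 0) :=
  ⟨hb, by simp, by simp⟩

theorem integral (hb : 0 ≤ b) (h : IntervalIntegrable u' volume 0 b) :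
    IsPrimitiveOn b (fun t => ∫ s in (0 : ℝ)..t, u' s) u' :=
  ⟨hb, h, by simp⟩

theorem add (hu : IsPrimitiveOn b u u') (hv : IsPrimitiveOn b v v') :
    IsPrimitiveOn b (fun t => u t + v t) (fun t => u' t + v' t) := by
  refine ⟨hu.nonneg, hu.intervalIntegrable.add hv.intervalIntegrable, fun t ht => ?_⟩
  rw [intervalIntegral.integral_add (hu.intervalIntegrable_of_mem hu.zero_mem ht)
    (hv.intervalIntegrable_of_mem hu.zero_mem ht), hu.integral_eq_sub hu.zero_mem ht,
    hv.integral_eq_sub hu.zero_mem ht]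
  ring

theorem const_mul (hu : IsPrimitiveOn b u u') (c : ℝ) :
    IsPrimitiveOn b (fun t => c * u t) (fun t => c * u' t) := by
  refine ⟨hu.nonneg, hu.intervalIntegrable.const_mul c, fun t ht => ?_⟩
  rw [intervalIntegral.integral_const_mul, hu.eq_add_integral t ht]
  ring

theorem neg (hu : IsPrimitiveOn b u u') : IsPrimitiveOn b (fun t => -u t) (fun t => -u' t) := by
  simpa using hu.const_mul (-1)

theorem sub (hu : IsPrimitiveOn b u u') (hv : IsPrimitiveOn b v v') :
    IsPrimitiveOn b (fun t => u t - v t) (fun t => u' t - v' t) := by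
  simpa [sub_eq_add_neg] using hu.add hv.neg

theorem ae_hasDerivAt_integral (hu : IsPrimitiveOn b u u') :
    ∀ᵐ x, x ∈ Icc 0 b → HasDerivAt (fun t => u 0 + ∫ s in (0 : ℝ)..t, u' s) (u' x) x := by
  filter_upwards [hu.intervalIntegrable.ae_hasDerivAt_integral] with x hx hxb
  rw [uIcc_of_le hu.nonneg] at hx
  exact (hx hxb 0 hu.zero_mem).const_add _

theorem absolutelyContinuousOnInterval_integral (hu : IsPrimitiveOn b u u') :
    AbsolutelyContinuousOnInterval (fun t => u 0 + ∫ s in (0 : ℝ)..t, u' s) 0 b := by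
  refine AbsolutelyContinuousOnInterval.add ?_
    (hu.intervalIntegrable.absolutelyContinuousOnInterval_intervalIntegral left_mem_uIcc)
  exact (LipschitzWith.const (u 0)).lipschitzOnWith.absolutelyContinuousOnInterval

/-- Integration by parts, applied to `u 0 + ∫ u'` rather than `u`: these canonical primitives are
absolutely continuous with known a.e. derivative, whereas `u` is controlled on `[0, b]` only. -/
theorem mul (hu : IsPrimitiveOn b u u') (hv : IsPrimitiveOn b v v') :
    IsPrimitiveOn b (fun t => u t * v t) (fun t => u' t * v t + u t * v' t) := by
  have hb := hu.nonneg
  refine ⟨hb, (hu.intervalIntegrable.mul_continuousOn ?_).add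
    (hv.intervalIntegrable.continuousOn_mul ?_), fun t ht => ?_⟩
  · rw [uIcc_of_le hb]; exact hv.continuousOn
  · rw [uIcc_of_le hb]; exact hu.continuousOn
  have hut := hu.mono ht
  have hvt := hv.mono ht
  have key := hut.absolutelyContinuousOnInterval_integral.integral_deriv_mul_eq_sub
    hvt.absolutelyContinuousOnInterval_integral
  rw [← hu.eq_add_integral t ht, ← hv.eq_add_integral t ht] at key
  simp only [intervalIntegral.integral_same, add_zero] at key
  rw [← sub_eq_iff_eq_add', ← key]
  refine (intervalIntegral.integral_congr_ae ?_).symm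
  filter_upwards [hut.ae_hasDerivAt_integral, hvt.ae_hasDerivAt_integral] with s hus hvs hs
  have hst : s ∈ Icc 0 t := Ioc_subset_Icc_self (by rwa [uIoc_of_le ht.1] at hs)
  rw [(hus hst).deriv, (hvs hst).deriv, ← hut.eq_add_integral s hst, ← hvt.eq_add_integral s hst]

theorem of_hasDerivAt (hb : 0 ≤ b) (hu : ContinuousOn u (Icc 0 b))
    (hu' : ContinuousOn u' (Icc 0 b)) (h : ∀ t ∈ Ioo 0 b, HasDerivAt u (u' t) t) :
    IsPrimitiveOn b u u' := by
  refine ⟨hb, hu'.intervalIntegrable_of_Icc hb, fun t ht => ?_⟩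
  rw [intervalIntegral.integral_eq_sub_of_hasDerivAt_of_le ht.1
    (hu.mono (Icc_subset_Icc_right ht.2))
    (fun s hs => h s ⟨hs.1, hs.2.trans_le ht.2⟩)
    ((hu'.mono (Icc_subset_Icc_right ht.2)).intervalIntegrable_of_Icc ht.1)]
  ring

theorem of_contDiffOn (hb : 0 < b) (hu : ContDiffOn ℝ 1 u (Icc 0 b)) :
    IsPrimitiveOn b u (derivWithin u (Icc 0 b)) := by
  refine of_hasDerivAt hb.le hu.continuousOn
    (hu.continuousOn_derivWithin (uniqueDiffOn_Icc hb) le_rfl) fun t ht => ?_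
  have := (hu.differentiableOn one_ne_zero t (Ioo_subset_Icc_self ht)).hasDerivWithinAt
  exact this.hasDerivAt (Icc_mem_nhds ht.1 ht.2)

theorem hasDerivAt_of_continuousOn (hu : IsPrimitiveOn b u u') (hu' : ContinuousOn u' (Icc 0 b))
    {t : ℝ} (ht : t ∈ Ioo 0 b) : HasDerivAt u (u' t) t := by
  have h : HasDerivAt (fun t => u 0 + ∫ s in (0 : ℝ)..t, u' s) (u' t) t := by
    refine HasDerivAt.const_add _ ?_
    refine intervalIntegral.integral_hasDerivAt_right
      (hu.intervalIntegrable_of_mem hu.zero_mem (Ioo_subset_Icc_self ht)) ?_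
      (hu'.continuousAt (Icc_mem_nhds ht.1 ht.2))
    exact (hu'.mono Ioo_subset_Icc_self).stronglyMeasurableAtFilter isOpen_Ioo t ht
  refine h.congr_of_eventuallyEq ?_
  filter_upwards [Icc_mem_nhds ht.1 ht.2] with s hs using hu.eq_add_integral s hs

theorem exp_integral (hb : 0 ≤ b) {φ : ℝ → ℝ} (hφ : ContinuousOn φ (Icc 0 b)) :
    IsPrimitiveOn b (fun t => Real.exp (∫ s in (0 : ℝ)..t, φ s))
      (fun t => φ t * Real.exp (∫ s in (0 : ℝ)..t, φ s)) := by
  have h := integral hb (hφ.intervalIntegrable_of_Icc hb)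
  have hc : ContinuousOn (fun t => Real.exp (∫ s in (0 : ℝ)..t, φ s)) (Icc 0 b) :=
    Real.continuous_exp.comp_continuousOn h.continuousOn
  refine of_hasDerivAt hb hc (hφ.mul hc) fun t ht => ?_
  have := (h.hasDerivAt_of_continuousOn hφ ht).exp
  rwa [mul_comm] at this

theorem inv (hu : IsPrimitiveOn b u u') (hu' : ContinuousOn u' (Icc 0 b))
    (h0 : ∀ t ∈ Icc 0 b, u t ≠ 0) :
    IsPrimitiveOn b (fun t => (u t)⁻¹) (fun t => -u' t / u t ^ 2) :=
  of_hasDerivAt hu.nonneg (hu.continuousOn.inv₀ h0)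
    (hu'.neg.div (hu.continuousOn.pow 2) fun t ht => pow_ne_zero 2 (h0 t ht))
    fun t ht => (hu.hasDerivAt_of_continuousOn hu' ht).inv (h0 t (Ioo_subset_Icc_self ht))

/-- The source of the conservation laws below: a quantity is assembled from products and sums, and
its formal derivative cancels algebraically. -/
theorem eq_of_deriv_eq_zero (hu : IsPrimitiveOn b u u') (h : ∀ t ∈ Icc 0 b, u' t = 0)
    {t : ℝ} (ht : t ∈ Icc 0 b) : u t = u 0 := by
  rw [hu.eq_add_integral t ht, intervalIntegral.integral_congr (g := fun _ => (0 : ℝ))]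
  · simp
  · intro s hs
    rw [uIcc_of_le ht.1] at hs
    exact h s ⟨hs.1, hs.2.trans ht.2⟩

end IsPrimitiveOn

/-! ### Linear equations with bounded measurable coefficients -/

section LinearODE

variable {E : Type*} [NormedAddCommGroup E] [NormedSpace ℝ E]

/-- The Picard increments of the linear equation `u' = M u`. -/
noncomputable def picardIncrement (M : ℝ → E →L[ℝ] E) (x : E) : ℕ → ℝ → E
  | 0 => fun _ => x
  | n + 1 => fun t => ∫ s in (0 : ℝ)..t, M s (picardIncrement M x n s)

theorem intervalIntegrable_clm_apply {M : ℝ → E →L[ℝ] E} (hM : StronglyMeasurable M) {C : ℝ}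
    (hC : ∀ s, ‖M s‖ ≤ C) {v : ℝ → E} {a b : ℝ} (hv : ContinuousOn v (uIcc a b)) :
    IntervalIntegrable (fun s => M s (v s)) volume a b := by
  have hv' : IntervalIntegrable v volume a b := hv.intervalIntegrable
  rw [intervalIntegrable_iff] at hv' ⊢
  refine (hv'.norm.const_mul C).mono'
    ((ContinuousLinearMap.id ℝ (E →L[ℝ] E)).aestronglyMeasurable_comp₂
      hM.aestronglyMeasurable hv'.aestronglyMeasurable) (.of_forall fun s => ?_)
  exact (M s).le_of_opNorm_le (hC s) _

theorem continuous_picardIncrement {M : ℝ → E →L[ℝ] E} (hM : StronglyMeasurable M) {C : ℝ}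
    (hC : ∀ s, ‖M s‖ ≤ C) (x : E) (n : ℕ) : Continuous (picardIncrement M x n) := by
  induction n with
  | zero => exact continuous_const
  | succ n ih =>
    exact intervalIntegral.continuous_primitive
      (fun a b => intervalIntegrable_clm_apply hM hC ih.continuousOn) 0

theorem norm_picardIncrement_le {M : ℝ → E →L[ℝ] E} {C : ℝ}
    (hC : ∀ s, ‖M s‖ ≤ C) (x : E) (n : ℕ) {t : ℝ} (ht : 0 ≤ t) :
    ‖picardIncrement M x n t‖ ≤ ‖x‖ * ((C * t) ^ n / n.factorial) := by
  induction n generalizing t with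
  | zero => simp [picardIncrement]
  | succ n ih =>
    have hC0 : 0 ≤ C := (norm_nonneg _).trans (hC 0)
    have h1 : ‖picardIncrement M x (n + 1) t‖ ≤
        ∫ s in (0 : ℝ)..t, C * (‖x‖ * ((C * s) ^ n / n.factorial)) := by
      refine intervalIntegral.norm_integral_le_of_norm_le ht (.of_forall fun s hs => ?_)
        (Continuous.intervalIntegrable (by fun_prop) _ _)
      exact ((M s).le_of_opNorm_le (hC s) _).trans (mul_le_mul_of_nonneg_left (ih hs.1.le) hC0)
    refine h1.trans_eq ?_
    have h2 : ∀ s : ℝ, C * (‖x‖ * ((C * s) ^ n / n.factorial)) =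
        (C ^ (n + 1) * ‖x‖ / n.factorial) * s ^ n := fun s => by ring
    simp_rw [h2]
    rw [intervalIntegral.integral_const_mul, integral_pow, Nat.factorial_succ]
    push_cast
    field_simp
    rw [mul_pow, zero_pow n.succ_ne_zero]
    ring

/-- A linear equation `u' = M u` with bounded measurable coefficients has a solution, in
integrated form, on `[0, b]`. -/
theorem exists_continuousOn_eq_add_integral_clm [CompleteSpace E] {M : ℝ → E →L[ℝ] E}
    (hM : StronglyMeasurable M) {C : ℝ} (hC : ∀ s, ‖M s‖ ≤ C) (x : E) (b : ℝ) :
    ∃ u : ℝ → E, ContinuousOn u (Icc 0 b) ∧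
      ∀ t ∈ Icc 0 b, u t = x + ∫ s in (0 : ℝ)..t, M s (u s) := by
  have hC0 : 0 ≤ C := (norm_nonneg _).trans (hC 0)
  have hbound : ∀ n, ∀ t ∈ Icc (0 : ℝ) b,
      ‖picardIncrement M x n t‖ ≤ ‖x‖ * ((C * b) ^ n / n.factorial) := fun n t ht =>
    (norm_picardIncrement_le hC x n ht.1).trans <| by
      have := mul_nonneg hC0 ht.1
      have := ht.2
      gcongr
  have hsum : Summable fun n : ℕ => ‖x‖ * ((C * b) ^ n / n.factorial) :=
    (Real.summable_pow_div_factorial (C * b)).mul_left _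
  have hu : ∀ t ∈ Icc (0 : ℝ) b,
      HasSum (fun n => picardIncrement M x n t) (∑' n, picardIncrement M x n t) := fun t ht =>
    (Summable.of_norm_bounded hsum fun n => hbound n t ht).hasSum
  refine ⟨fun t => ∑' n, picardIncrement M x n t, ?_, fun t ht => ?_⟩
  · exact continuousOn_tsum (fun n => (continuous_picardIncrement hM hC x n).continuousOn) hsum
      fun n t ht => hbound n t ht
  -- Termwise integration by dominated convergence: the integral of `M u` is the Picard series
  -- without its zeroth term `x`.
  have h1 : HasSum (fun n => ∫ s in (0 : ℝ)..t, M s (picardIncrement M x n s))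
      (∫ s in (0 : ℝ)..t, M s (∑' n, picardIncrement M x n s)) := by
    refine intervalIntegral.hasSum_integral_of_dominated_convergence
      (fun n _ => C * (‖x‖ * ((C * b) ^ n / n.factorial))) (fun n => ?_) (fun n => ?_) ?_ ?_ ?_
    · exact (ContinuousLinearMap.id ℝ (E →L[ℝ] E)).aestronglyMeasurable_comp₂
        hM.aestronglyMeasurable (continuous_picardIncrement hM hC x n).aestronglyMeasurable
    · refine .of_forall fun s hs => ?_
      rw [uIoc_of_le ht.1] at hs
      exact ((M s).le_of_opNorm_le (hC s) _).trans
        (mul_le_mul_of_nonneg_left (hbound n s ⟨hs.1.le, hs.2.trans ht.2⟩) hC0)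
    · exact .of_forall fun s _ => hsum.mul_left C
    · exact intervalIntegrable_const
    · refine .of_forall fun s hs => ?_
      rw [uIoc_of_le ht.1] at hs
      exact (hu s ⟨hs.1.le, hs.2.trans ht.2⟩).mapL (M s)
  have h2 := (hu t ht).summable.tsum_eq_zero_add
  refine h2.trans ?_
  congr 1
  exact h1.tsum_eq

/-- The integrated form of the planar linear system with bounded measurable coefficients. -/
theorem exists_planar_linear_system {m₁₁ m₁₂ m₂₁ : ℝ → ℝ} (h₁₁ : Measurable m₁₁)
    (h₁₂ : Measurable m₁₂) (h₂₁ : Measurable m₂₁) {C : ℝ} (hC₁₁ : ∀ s, |m₁₁ s| ≤ C)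
    (hC₁₂ : ∀ s, |m₁₂ s| ≤ C) (hC₂₁ : ∀ s, |m₂₁ s| ≤ C) (x y : ℝ) {b : ℝ} (hb : 0 ≤ b) :
    ∃ X Y : ℝ → ℝ, X 0 = x ∧ Y 0 = y ∧
      IsPrimitiveOn b X (fun s => m₁₁ s * X s + m₁₂ s * Y s) ∧
      IsPrimitiveOn b Y (fun s => m₂₁ s * X s) := by
  let p₁ := ContinuousLinearMap.fst ℝ ℝ ℝ
  let p₂ := ContinuousLinearMap.snd ℝ ℝ ℝ
  let i₁ := ContinuousLinearMap.inl ℝ ℝ ℝ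
  let i₂ := ContinuousLinearMap.inr ℝ ℝ ℝ
  let M : ℝ → (ℝ × ℝ) →L[ℝ] (ℝ × ℝ) := fun s =>
    m₁₁ s • i₁.comp p₁ + m₁₂ s • i₁.comp p₂ + m₂₁ s • i₂.comp p₁
  have hM : StronglyMeasurable M :=
    ((h₁₁.stronglyMeasurable.smul_const _).add (h₁₂.stronglyMeasurable.smul_const _)).add
      (h₂₁.stronglyMeasurable.smul_const _)
  have hMC : ∀ s, ‖M s‖ ≤ C * ‖i₁.comp p₁‖ + C * ‖i₁.comp p₂‖ + C * ‖i₂.comp p₁‖ := fun s => by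
    refine (norm_add₃_le).trans ?_
    rw [norm_smul, norm_smul, norm_smul]
    gcongr
    exacts [hC₁₁ s, hC₁₂ s, hC₂₁ s]
  obtain ⟨u, hu, hu'⟩ := exists_continuousOn_eq_add_integral_clm hM hMC (x, y) b
  have hint : ∀ t ∈ Icc 0 b, IntervalIntegrable (fun s => M s (u s)) volume 0 t := fun t ht =>
    intervalIntegrable_clm_apply hM hMC <| hu.mono <| by
      rw [uIcc_of_le ht.1]; exact Icc_subset_Icc_right ht.2
  have h0 : u 0 = (x, y) := by simpa using hu' 0 ⟨le_rfl, hb⟩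
  have hb' : b ∈ Icc 0 b := ⟨hb, le_rfl⟩
  have hM₁ : ∀ s, p₁ (M s (u s)) = m₁₁ s * (u s).1 + m₁₂ s * (u s).2 := fun s => by
    simp [M, i₁, i₂, p₁, p₂]
  have hM₂ : ∀ s, p₂ (M s (u s)) = m₂₁ s * (u s).1 := fun s => by simp [M, i₁, i₂, p₁, p₂]
  refine ⟨fun s => (u s).1, fun s => (u s).2, by simp [h0], by simp [h0], ?_⟩
  simp only [← hM₁, ← hM₂]
  refine ⟨⟨hb, ?_, fun t ht => ?_⟩,
    ⟨hb, ?_, fun t ht => ?_⟩⟩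
  · exact ⟨p₁.integrable_comp (hint b hb').1, p₁.integrable_comp (hint b hb').2⟩
  · rw [p₁.intervalIntegral_comp_comm (hint t ht), h0, hu' t ht]
    rfl
  · exact ⟨p₂.integrable_comp (hint b hb').1, p₂.integrable_comp (hint b hb').2⟩
  · rw [p₂.intervalIntegral_comp_comm (hint t ht), h0, hu' t ht]
    rfl

end LinearODE

/-! ### The homogeneous system: fundamental solutions, energy, existence for the Riccati equation -/

namespace LiquidationGame

/-- The standing assumptions on the coefficients of the liquidation game. -/
structure Coefficients.IsAdmissible (P : Coefficients) : Prop where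
  T_pos : 0 < P.T
  η_contDiffOn : ContDiffOn ℝ 1 P.η (Icc 0 P.T)
  η_pos : ∀ t ∈ Icc 0 P.T, 0 < P.η t
  κ_contDiffOn : ContDiffOn ℝ 1 P.κ (Icc 0 P.T)
  κ_nonneg : ∀ t ∈ Icc 0 P.T, 0 ≤ P.κ t
  lam_memLp : MemLp P.lam ⊤ (volume.restrict (Icc 0 P.T))
  lam_nonneg : ∀ᵐ t ∂(volume.restrict (Icc 0 P.T)), 0 ≤ P.lam t
  cost_nonneg : ∀ᵐ t ∂(volume.restrict (Icc 0 P.T)), 0 ≤ P.lam t + P.δ * P.κ' t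

variable {P : Coefficients}

namespace Coefficients.IsAdmissible

theorem zero_mem (hP : P.IsAdmissible) : (0 : ℝ) ∈ Icc 0 P.T := ⟨le_rfl, hP.T_pos.le⟩

theorem T_mem (hP : P.IsAdmissible) : P.T ∈ Icc 0 P.T := ⟨hP.T_pos.le, le_rfl⟩

theorem η_ne_zero (hP : P.IsAdmissible) {t : ℝ} (ht : t ∈ Icc 0 P.T) : P.η t ≠ 0 :=
  (hP.η_pos t ht).ne'

theorem continuousOn_rate (hP : P.IsAdmissible) :
    ContinuousOn (fun t => P.δ * P.κ t / P.η t) (Icc 0 P.T) :=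
  (hP.κ_contDiffOn.continuousOn.const_smul P.δ).div hP.η_contDiffOn.continuousOn
    fun _ ht => hP.η_ne_zero ht

theorem ae_lam_nonneg (hP : P.IsAdmissible) : ∀ᵐ t, t ∈ Icc 0 P.T → 0 ≤ P.lam t :=
  (ae_restrict_iff' measurableSet_Icc).1 hP.lam_nonneg

theorem ae_cost_nonneg (hP : P.IsAdmissible) :
    ∀ᵐ t, t ∈ Icc 0 P.T → 0 ≤ P.lam t + P.δ * P.κ' t :=
  (ae_restrict_iff' measurableSet_Icc).1 hP.cost_nonneg

theorem exists_lam_bound (hP : P.IsAdmissible) :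
    ∃ C, 0 ≤ C ∧ ∀ᵐ t, t ∈ Icc 0 P.T → |P.lam t| ≤ C := by
  refine ⟨(eLpNorm P.lam ⊤ (volume.restrict (Icc 0 P.T))).toReal, ENNReal.toReal_nonneg, ?_⟩
  rw [← ae_restrict_iff' measurableSet_Icc]
  filter_upwards [enorm_ae_le_eLpNormEssSup P.lam (volume.restrict (Icc 0 P.T))] with t ht
  have h := hP.lam_memLp.2.ne
  rw [eLpNorm_exponent_top] at h ⊢
  simpa using ENNReal.toReal_mono h ht

/-- Picard iteration needs a coefficient that is measurable and bounded everywhere. Truncating a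
measurable representative at the essential bound changes `lam` only on a null subset of `[0, T]`. -/
theorem exists_measurable_lam (hP : P.IsAdmissible) :
    ∃ ℓ : ℝ → ℝ, Measurable ℓ ∧ (∃ C, ∀ t, |ℓ t| ≤ C) ∧ ∀ᵐ t, t ∈ Icc 0 P.T → P.lam t = ℓ t := by
  obtain ⟨C, hC0, hC⟩ := hP.exists_lam_bound
  have hm := hP.lam_memLp.1
  refine ⟨fun t => max (-C) (min C (hm.mk P.lam t)),
    measurable_const.max (measurable_const.min hm.stronglyMeasurable_mk.measurable),
    ⟨C, fun t => abs_le.2 ⟨le_max_left _ _, max_le (by linarith) (min_le_left _ _)⟩⟩, ?_⟩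
  filter_upwards [hC, (ae_restrict_iff' measurableSet_Icc).1 hm.ae_eq_mk] with t h1 h2 ht
  have h3 := abs_le.1 (h1 ht)
  rw [← h2 ht, min_eq_right h3.2, max_eq_right h3.1]

end Coefficients.IsAdmissible

/-- `(X, Y)` solves the homogeneous forward-backward system on `[0, b]`. -/
structure IsHomogeneousSolution (P : Coefficients) (b : ℝ) (X Y : ℝ → ℝ) : Prop where
  fst : IsPrimitiveOn b X (fun s => -((Y s - P.δ * P.κ s * X s) / P.η s))
  snd : IsPrimitiveOn b Y (fun s => -(P.lam s * X s))

theorem exists_isHomogeneousSolution (hP : P.IsAdmissible) (x y : ℝ) :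
    ∃ X Y : ℝ → ℝ, X 0 = x ∧ Y 0 = y ∧ IsHomogeneousSolution P P.T X Y := by
  obtain ⟨ℓ, hℓm, ⟨C, hℓC⟩, hℓ⟩ := hP.exists_measurable_lam
  have hT := hP.T_pos.le
  -- The continuous coefficients are extended by their endpoint values, which makes them bounded on
  -- the whole line.
  have hbounded : ∀ φ : ℝ → ℝ, ContinuousOn φ (Icc 0 P.T) →
      Continuous (fun t => φ (projIcc 0 P.T hT t)) ∧ ∃ C, ∀ t, |φ (projIcc 0 P.T hT t)| ≤ C := by
    intro φ hφ
    refine ⟨hφ.comp_continuous (by fun_prop) fun t => (projIcc 0 P.T hT t).2, ?_⟩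
    obtain ⟨C, hC⟩ := isCompact_Icc.exists_bound_of_continuousOn hφ
    exact ⟨C, fun t => hC _ (projIcc 0 P.T hT t).2⟩
  obtain ⟨ha, Ca, hCa⟩ := hbounded _ hP.continuousOn_rate
  obtain ⟨hb, Cb, hCb⟩ := hbounded (fun t => -(P.η t)⁻¹)
    (hP.η_contDiffOn.continuousOn.inv₀ fun t ht => hP.η_ne_zero ht).neg
  obtain ⟨X, Y, hX0, hY0, hX, hY⟩ := exists_planar_linear_system ha.measurable hb.measurable
    hℓm.neg (C := max (max Ca Cb) C)
    (fun s => (hCa s).trans ((le_max_left _ _).trans (le_max_left _ _)))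
    (fun s => (hCb s).trans ((le_max_right _ _).trans (le_max_left _ _)))
    (fun s => by rw [Pi.neg_apply, abs_neg]; exact (hℓC s).trans (le_max_right _ _)) x y hT
  refine ⟨X, Y, hX0, hY0, hX.congr_deriv fun t ht => ?_, hY.congr_ae (fun _ _ => rfl) ?_⟩
  · rw [projIcc_of_mem hT ht]
    ring
  · filter_upwards [hℓ] with t h ht
    simp [h (Ioc_subset_Icc_self ht)]

/-- The discount factor `exp(-∫₀ᵗ δ κ / η)`. -/
noncomputable def discount (P : Coefficients) (t : ℝ) : ℝ :=
  Real.exp (∫ s in (0 : ℝ)..t, -(P.δ * P.κ s / P.η s))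

theorem discount_pos (P : Coefficients) (t : ℝ) : 0 < discount P t := Real.exp_pos _

theorem discount_zero (P : Coefficients) : discount P 0 = 1 := by simp [discount]

theorem isPrimitiveOn_discount (hP : P.IsAdmissible) :
    IsPrimitiveOn P.T (discount P) (fun t => -(P.δ * P.κ t / P.η t) * discount P t) :=
  .exp_integral hP.T_pos.le hP.continuousOn_rate.neg

/-- A fundamental system of the homogeneous forward-backward system. -/
structure IsFundamentalSystem (P : Coefficients) (X₁ Y₁ X₂ Y₂ : ℝ → ℝ) : Prop where
  fst : IsHomogeneousSolution P P.T X₁ Y₁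
  snd : IsHomogeneousSolution P P.T X₂ Y₂
  X₁_zero : X₁ 0 = 1
  Y₁_zero : Y₁ 0 = 0
  X₂_zero : X₂ 0 = 0
  Y₂_zero : Y₂ 0 = 1

theorem exists_isFundamentalSystem (hP : P.IsAdmissible) :
    ∃ X₁ Y₁ X₂ Y₂ : ℝ → ℝ, IsFundamentalSystem P X₁ Y₁ X₂ Y₂ := by
  obtain ⟨X₁, Y₁, h1, h2, h3⟩ := exists_isHomogeneousSolution hP 1 0
  obtain ⟨X₂, Y₂, h4, h5, h6⟩ := exists_isHomogeneousSolution hP 0 1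
  exact ⟨X₁, Y₁, X₂, Y₂, h3, h6, h1, h2, h4, h5⟩

/-- The energy identity: the discounted product `X Y` decreases at the rate
`(Y² / η + lam X²) exp(-∫ δ κ / η)`. -/
theorem IsHomogeneousSolution.energy (hP : P.IsAdmissible) {X Y : ℝ → ℝ}
    (h : IsHomogeneousSolution P P.T X Y) :
    IsPrimitiveOn P.T (fun t => X t * Y t * discount P t)
      (fun t => -((Y t ^ 2 / P.η t + P.lam t * X t ^ 2) * discount P t)) :=
  ((h.fst.mul h.snd).mul (isPrimitiveOn_discount hP)).congr_deriv fun t ht => by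
    have := hP.η_ne_zero ht
    field_simp
    ring

theorem IsHomogeneousSolution.energy_lt (hP : P.IsAdmissible) {X Y : ℝ → ℝ}
    (h : IsHomogeneousSolution P P.T X Y) {s t : ℝ} (hs : 0 ≤ s) (hst : s < t) (ht : t ≤ P.T)
    (hY : Y s ≠ 0 ∨ Y t ≠ 0) :
    X t * Y t * discount P t < X s * Y s * discount P s := by
  have hsT : s ∈ Icc 0 P.T := ⟨hs, hst.le.trans ht⟩
  have htT : t ∈ Icc 0 P.T := ⟨hs.trans hst.le, ht⟩
  have hsub : Icc s t ⊆ Icc 0 P.T := Icc_subset_Icc hs ht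
  have hE := h.energy hP
  have hcont : ContinuousOn (fun r => Y r ^ 2 / P.η r * discount P r) (Icc s t) :=
    (((h.snd.continuousOn.pow 2).div hP.η_contDiffOn.continuousOn
      fun r hr => hP.η_ne_zero hr).mul (isPrimitiveOn_discount hP).continuousOn).mono hsub
  have hnonneg : ∀ r ∈ Icc 0 P.T, 0 ≤ Y r ^ 2 / P.η r * discount P r := fun r hr =>
    mul_nonneg (div_nonneg (sq_nonneg _) (hP.η_pos r hr).le) (discount_pos P r).le
  have h1 : 0 < ∫ r in s..t, Y r ^ 2 / P.η r * discount P r := by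
    refine intervalIntegral.integral_pos hst hcont
      (fun r hr => hnonneg r (hsub (Ioc_subset_Icc_self hr))) ?_
    have hpos : ∀ r ∈ Icc 0 P.T, Y r ≠ 0 → 0 < Y r ^ 2 / P.η r * discount P r := fun r hr h0 =>
      mul_pos (div_pos (by positivity) (hP.η_pos r hr)) (discount_pos P r)
    rcases hY with hY | hY
    · exact ⟨s, left_mem_Icc.2 hst.le, hpos s hsT hY⟩
    · exact ⟨t, right_mem_Icc.2 hst.le, hpos t htT hY⟩
  have h2 : ∫ r in s..t, Y r ^ 2 / P.η r * discount P r ≤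
      -∫ r in s..t, -((Y r ^ 2 / P.η r + P.lam r * X r ^ 2) * discount P r) := by
    rw [← intervalIntegral.integral_neg]
    refine intervalIntegral.integral_mono_ae_restrict hst.le
      (hcont.intervalIntegrable_of_Icc hst.le) (hE.intervalIntegrable_of_mem hsT htT).neg ?_
    rw [EventuallyLE, ae_restrict_iff' measurableSet_Icc]
    filter_upwards [hP.ae_lam_nonneg] with r hr hr'
    have := mul_nonneg (mul_nonneg (hr (hsub hr')) (sq_nonneg (X r))) (discount_pos P r).le
    linarith
  rw [hE.integral_eq_sub hsT htT] at h2
  linarith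

namespace IsFundamentalSystem

variable {X₁ Y₁ X₂ Y₂ : ℝ → ℝ}

/-- The trace of the system matrix is `δκ/η`, which the discount factor compensates. -/
theorem wronskian (hP : P.IsAdmissible) (h : IsFundamentalSystem P X₁ Y₁ X₂ Y₂) {t : ℝ}
    (ht : t ∈ Icc 0 P.T) : (X₁ t * Y₂ t - X₂ t * Y₁ t) * discount P t = 1 := by
  have h1 := (((h.fst.fst.mul h.snd.snd).sub (h.snd.fst.mul h.fst.snd)).mul
    (isPrimitiveOn_discount hP)).eq_of_deriv_eq_zero (fun s hs => by
      have := hP.η_ne_zero hs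
      field_simp
      ring) ht
  simpa [h.X₁_zero, h.X₂_zero, h.Y₁_zero, h.Y₂_zero, discount_zero] using h1

/-- The discounted `X₂ Y₂` starts at `0` and strictly decreases, so `Y₂` cannot return to zero. -/
theorem Y₂_pos (hP : P.IsAdmissible) (h : IsFundamentalSystem P X₁ Y₁ X₂ Y₂) {t : ℝ}
    (ht : t ∈ Icc 0 P.T) : 0 < Y₂ t := by
  by_contra! hneg
  obtain ⟨s, hs, hs0⟩ : (0 : ℝ) ∈ Y₂ '' Icc 0 t :=
    intermediate_value_Icc' ht.1 (h.snd.snd.continuousOn.mono (Icc_subset_Icc_right ht.2))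
      ⟨hneg, by simp [h.Y₂_zero]⟩
  have hs0' : 0 < s := hs.1.lt_of_ne fun h0 => by
    rw [← h0, h.Y₂_zero] at hs0; exact one_ne_zero hs0
  have := h.snd.energy_lt hP le_rfl hs0' (hs.2.trans ht.2) (.inl (by simp [h.Y₂_zero]))
  simp [hs0, h.X₂_zero] at this

theorem X₂_neg (hP : P.IsAdmissible) (h : IsFundamentalSystem P X₁ Y₁ X₂ Y₂) {t : ℝ}
    (ht : t ∈ Ioc 0 P.T) : X₂ t < 0 := by
  have := h.snd.energy_lt hP le_rfl ht.1 ht.2 (.inl (by simp [h.Y₂_zero]))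
  have h2 := h.Y₂_pos hP (Ioc_subset_Icc_self ht)
  have h3 := discount_pos P t
  rw [h.X₂_zero, zero_mul, zero_mul, mul_assoc] at this
  exact neg_of_mul_neg_left this (mul_pos h2 h3).le

end IsFundamentalSystem

theorem isHomogeneousSolution_linearCombination {X₁ Y₁ X₂ Y₂ : ℝ → ℝ}
    (h₁ : IsHomogeneousSolution P P.T X₁ Y₁) (h₂ : IsHomogeneousSolution P P.T X₂ Y₂) (r : ℝ) :
    IsHomogeneousSolution P P.T (fun t => X₁ t + r * X₂ t) (fun t => Y₁ t + r * Y₂ t) :=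
  ⟨(h₁.fst.add (h₂.fst.const_mul r)).congr_deriv fun t _ => by ring,
    (h₁.snd.add (h₂.snd.const_mul r)).congr_deriv fun t _ => by ring⟩

/-- The Riccati substitution `A = V / w`, where `(w, V)` is the homogeneous solution with `w T = 0`.
Positivity of `w` before `T` and of `V` up to `T` makes the quotient regular on `[0, T)` and
divergent at `T`. -/
theorem exists_isRiccatiSolution (hP : P.IsAdmissible) : ∃ A, IsRiccatiSolution P A := by
  obtain ⟨X₁, Y₁, X₂, Y₂, h⟩ := exists_isFundamentalSystem hP
  have hT := hP.T_pos
  have hX₂T : X₂ P.T < 0 := h.X₂_neg hP ⟨hT, le_rfl⟩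
  obtain ⟨r, hr⟩ : ∃ r, r = -X₁ P.T / X₂ P.T := ⟨_, rfl⟩
  have hw := isHomogeneousSolution_linearCombination h.fst h.snd r
  obtain ⟨w, hw_def⟩ : ∃ w, w = fun t => X₁ t + r * X₂ t := ⟨_, rfl⟩
  obtain ⟨V, hV_def⟩ : ∃ V, V = fun t => Y₁ t + r * Y₂ t := ⟨_, rfl⟩
  rw [← hw_def, ← hV_def] at hw
  have hwT : w P.T = 0 := by
    rw [hw_def, hr]
    field_simp [hX₂T.ne]
    ring
  have hwr := h.wronskian hP hP.T_mem
  -- As `w` vanishes at `T`, the Wronskian there reduces to `V (-X₂)` times the discount.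
  have hVT : 0 < V P.T := by
    have h1 : V P.T * (-X₂ P.T) * discount P P.T = 1 := by
      rw [← hwr, hV_def]
      have : X₁ P.T = - r * X₂ P.T := by rw [hr]; field_simp [hX₂T.ne]
      rw [this]
      ring
    have h2 := discount_pos P P.T
    by_contra! hneg
    nlinarith [mul_nonneg (mul_nonneg (neg_nonneg.2 hneg) (neg_nonneg.2 hX₂T.le)) h2.le]
  have hprod : ∀ t ∈ Ico 0 P.T, 0 < w t * V t := fun t ht => by
    have := hw.energy_lt hP ht.1 ht.2 le_rfl (.inr hVT.ne')
    rw [hwT, zero_mul, zero_mul] at this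
    exact pos_of_mul_pos_left this (discount_pos P t).le
  have hVpos : ∀ t ∈ Icc 0 P.T, 0 < V t := fun t ht => by
    by_contra! hneg
    obtain ⟨s, hs, hs0⟩ : (0 : ℝ) ∈ V '' Icc t P.T :=
      intermediate_value_Icc ht.2 (hw.snd.continuousOn.mono (Icc_subset_Icc_left ht.1))
        ⟨hneg, hVT.le⟩
    have hsT : s < P.T := hs.2.lt_of_ne fun h0 => by rw [h0] at hs0; exact hVT.ne' hs0
    have := hprod s ⟨ht.1.trans hs.1, hsT⟩
    simp [hs0] at this
  have hwpos : ∀ t ∈ Ico 0 P.T, 0 < w t := fun t ht =>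
    pos_of_mul_pos_left (hprod t ht) (hVpos t (Ico_subset_Icc_self ht)).le
  have hw' : ContinuousOn (fun s => -((V s - P.δ * P.κ s * w s) / P.η s)) (Icc 0 P.T) :=
    ((hw.snd.continuousOn.sub ((hP.κ_contDiffOn.continuousOn.const_smul P.δ).mul
      hw.fst.continuousOn)).div hP.η_contDiffOn.continuousOn fun t ht => hP.η_ne_zero ht).neg
  refine ⟨fun t => V t * (w t)⁻¹, ?_, fun t ht => ?_, ?_⟩
  · exact (hw.snd.continuousOn.mono Ico_subset_Icc_self).mul
      ((hw.fst.continuousOn.mono Ico_subset_Icc_self).inv₀ fun t ht => (hwpos t ht).ne')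
  · have htT : t ∈ Icc 0 P.T := Ico_subset_Icc_self ht
    have hsub : Icc 0 t ⊆ Icc 0 P.T := Icc_subset_Icc_right ht.2.le
    have h1 := (hw.snd.mono htT).mul ((hw.fst.mono htT).inv (hw'.mono hsub)
      fun s hs => (hwpos s ⟨hs.1, hs.2.trans_lt ht.2⟩).ne')
    refine (h1.congr_deriv fun s hs => ?_).eq_add_integral t ⟨ht.1, le_rfl⟩
    have h2 := (hwpos s ⟨hs.1, hs.2.trans_lt ht.2⟩).ne'
    have h3 := hP.η_ne_zero (hsub hs)
    field_simp
    ring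
  · have hcw : Tendsto w (𝓝[<] P.T) (𝓝 0) := by
      have := (hw.fst.continuousOn P.T hP.T_mem).mono_left
        (nhdsWithin_le_of_mem (Icc_mem_nhdsLT hT))
      rwa [hwT] at this
    have hcV : Tendsto V (𝓝[<] P.T) (𝓝 (V P.T)) :=
      (hw.snd.continuousOn P.T hP.T_mem).mono_left (nhdsWithin_le_of_mem (Icc_mem_nhdsLT hT))
    refine hcV.pos_mul_atTop hVT (Tendsto.inv_tendsto_nhdsGT_zero ?_)
    refine tendsto_nhdsWithin_iff.2 ⟨hcw, ?_⟩
    filter_upwards [Ico_mem_nhdsLT hT] with t ht using hwpos t ht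

theorem isRiccatiSolution_riccati (hP : P.IsAdmissible) : IsRiccatiSolution P (riccati P) :=
  Classical.epsilon_spec (exists_isRiccatiSolution hP)

end LiquidationGame

/-! ### The kernel `h` in terms of the fundamental system -/

namespace LiquidationGame

variable {P : Coefficients}

theorem Coefficients.IsAdmissible.intervalIntegrable_lam (hP : P.IsAdmissible) :
    IntervalIntegrable P.lam volume 0 P.T :=
  (intervalIntegrable_iff_integrableOn_Icc_of_le hP.T_pos.le).2 <|
    hP.lam_memLp.integrable (by simp)

theorem IsRiccatiSolution.isPrimitiveOn (hP : P.IsAdmissible) {A : ℝ → ℝ}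
    (hA : IsRiccatiSolution P A) {b : ℝ} (hb : b ∈ Ico 0 P.T) :
    IsPrimitiveOn b A
      (fun s => (A s) ^ 2 / P.η s - P.δ * (P.κ s / P.η s) * A s - P.lam s) := by
  have hsub : Icc 0 b ⊆ Icc 0 P.T := Icc_subset_Icc_right hb.2.le
  have hsub' : Icc 0 b ⊆ Ico 0 P.T := fun s hs => ⟨hs.1, hs.2.trans_lt hb.2⟩
  refine ⟨hb.1, ?_, fun t ht => hA.eq t (hsub' ht)⟩
  have hA' := hA.continuousOn.mono hsub'
  have hη := hP.η_contDiffOn.continuousOn.mono hsub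
  have hκ := hP.κ_contDiffOn.continuousOn.mono hsub
  have h0 : ∀ t ∈ Icc 0 b, P.η t ≠ 0 := fun t ht => hP.η_ne_zero (hsub ht)
  refine IntervalIntegrable.sub (ContinuousOn.intervalIntegrable_of_Icc hb.1 ?_)
    (hP.intervalIntegrable_lam.mono_set ?_)
  · exact ((hA'.pow 2).div hη h0).sub ((continuousOn_const.mul (hκ.div hη h0)).mul hA')
  · rw [uIcc_of_le hb.1, uIcc_of_le hP.T_pos.le]
    exact hsub

/-- The Riccati equation turns the left side into a solution of `u' = (A/η) u` with `u 0 = 1`. Since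
this holds for any Riccati solution, the arbitrary choice in `riccati` does not affect `h`. -/
theorem IsRiccatiSolution.eq_exp (hP : P.IsAdmissible) {A X₁ Y₁ X₂ Y₂ : ℝ → ℝ}
    (hA : IsRiccatiSolution P A) (hF : IsFundamentalSystem P X₁ Y₁ X₂ Y₂) {t : ℝ}
    (ht : t ∈ Ico 0 P.T) :
    Y₂ t - A t * X₂ t = Real.exp (∫ s in (0 : ℝ)..t, A s / P.η s) := by
  have hsub : Icc 0 t ⊆ Icc 0 P.T := Icc_subset_Icc_right ht.2.le
  have htT := Ico_subset_Icc_self ht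
  have hAη : ContinuousOn (fun s => A s / P.η s) (Icc 0 t) :=
    (hA.isPrimitiveOn hP ht).continuousOn.div (hP.η_contDiffOn.continuousOn.mono hsub)
      fun s hs => hP.η_ne_zero (hsub hs)
  have hAη' : ContinuousOn (fun s => -(A s / P.η s)) (Icc 0 t) := hAη.neg
  have h1 := (((hF.snd.snd.mono htT).sub ((hA.isPrimitiveOn hP ht).mul
    (hF.snd.fst.mono htT))).mul (.exp_integral ht.1 hAη')).eq_of_deriv_eq_zero (fun s hs => by
      have := hP.η_ne_zero (hsub hs)
      field_simp
      ring) ⟨ht.1, le_rfl⟩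
  simp only [hF.X₂_zero, hF.Y₂_zero, intervalIntegral.integral_neg, Real.exp_neg,
    intervalIntegral.integral_same, Real.exp_zero, mul_zero, sub_zero, mul_one] at h1
  rw [mul_inv_eq_iff_eq_mul₀ (Real.exp_ne_zero _), one_mul] at h1
  exact h1

/-- The function `h^δ` solves the adjoint linear system. -/
theorem h_eq (hP : P.IsAdmissible) {X₁ Y₁ X₂ Y₂ : ℝ → ℝ}
    (hF : IsFundamentalSystem P X₁ Y₁ X₂ Y₂) {t : ℝ} (ht : t ∈ Ico 0 P.T) :
    h P t = -(X₂ t * discount P t) := by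
  have hA := isRiccatiSolution_riccati hP
  have hsub : Icc 0 t ⊆ Icc 0 P.T := Icc_subset_Icc_right ht.2.le
  have htT := Ico_subset_Icc_self ht
  have hη := hP.η_contDiffOn.continuousOn.mono hsub
  have hη0 : ∀ s ∈ Icc 0 t, P.η s ≠ 0 := fun s hs => hP.η_ne_zero (hsub hs)
  have hAη : ContinuousOn (fun s => riccati P s / P.η s) (Icc 0 t) :=
    (hA.isPrimitiveOn hP ht).continuousOn.div hη hη0
  -- By `eq_exp`, minus the derivative of `X₂ · discount · exp(∫ A/η)` is the integrand defining
  -- `h`.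
  have h1 := ((hF.snd.fst.mono htT).mul ((isPrimitiveOn_discount hP).mono htT)).mul
    (.exp_integral ht.1 hAη)
  have h2 : ∀ s ∈ Icc 0 t,
      1 / P.η s * Real.exp (∫ r in (0 : ℝ)..s, (2 * riccati P r - P.δ * P.κ r) / P.η r) =
        -((-((Y₂ s - P.δ * P.κ s * X₂ s) / P.η s) * discount P s +
          X₂ s * (-(P.δ * P.κ s / P.η s) * discount P s)) *
            Real.exp (∫ r in (0 : ℝ)..s, riccati P r / P.η r) +
          X₂ s * discount P s * (riccati P s / P.η s *
            Real.exp (∫ r in (0 : ℝ)..s, riccati P r / P.η r))) := by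
    intro s hs
    have h3 := hA.eq_exp hP hF (t := s) ⟨hs.1, hs.2.trans_lt ht.2⟩
    have h4 : Real.exp (∫ r in (0 : ℝ)..s, (2 * riccati P r - P.δ * P.κ r) / P.η r) =
        Real.exp (∫ r in (0 : ℝ)..s, riccati P r / P.η r) *
          Real.exp (∫ r in (0 : ℝ)..s, riccati P r / P.η r) * discount P s := by
      have hi1 := (hAη.mono (Icc_subset_Icc_right hs.2)).intervalIntegrable_of_Icc
        (μ := volume) hs.1
      have hi2 : IntervalIntegrable (fun r => -(P.δ * P.κ r / P.η r)) volume 0 s :=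
        (hP.continuousOn_rate.neg.mono
          ((Icc_subset_Icc_right hs.2).trans hsub)).intervalIntegrable_of_Icc hs.1
      rw [discount, ← Real.exp_add, ← Real.exp_add, ← intervalIntegral.integral_add hi1 hi1,
        ← intervalIntegral.integral_add (hi1.add hi1) hi2]
      congr 1
      refine intervalIntegral.integral_congr fun r _ => ?_
      ring
    rw [h4]
    have h5 := hη0 s hs
    nth_rewrite 1 [← h3]
    field_simp
    ring
  rw [h, intervalIntegral.integral_congr fun s hs => h2 s (by rwa [uIcc_of_le ht.1] at hs),
    intervalIntegral.integral_neg, h1.integral_eq_sub h1.zero_mem ⟨ht.1, le_rfl⟩, hF.X₂_zero,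
    Real.exp_neg]
  have := Real.exp_ne_zero (∫ s in (0 : ℝ)..t, riccati P s / P.η s)
  field_simp
  ring

end LiquidationGame

/-! ### Variation of constants, hitting times and the stopped system -/

theorem intervalIntegral_ite_le {φ : ℝ → ℝ} {c t : ℝ} (hc : 0 ≤ c) (ht : 0 ≤ t) :
    ∫ s in (0 : ℝ)..t, (if s ≤ c then φ s else 0) = ∫ s in (0 : ℝ)..min t c, φ s := by
  rcases le_total t c with htc | htc
  · rw [min_eq_left htc]
    refine intervalIntegral.integral_congr fun s hs => ?_
    rw [uIcc_of_le ht] at hs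
    exact if_pos (hs.2.trans htc)
  · rw [min_eq_right htc]
    exact intervalIntegral.integral_indicator (f := φ) ⟨hc, htc⟩

theorem IntervalIntegrable.ite_le {φ : ℝ → ℝ} {a b : ℝ} (hφ : IntervalIntegrable φ volume a b)
    (c : ℝ) : IntervalIntegrable (fun s => if s ≤ c then φ s else 0) volume a b :=
  ⟨hφ.1.indicator measurableSet_Iic, hφ.2.indicator measurableSet_Iic⟩

theorem IsPrimitiveOn.stopped {b c : ℝ} {u u' : ℝ → ℝ} (hu : IsPrimitiveOn b u u')
    (hc : c ∈ Icc 0 b) :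
    IsPrimitiveOn b (fun t => u (min t c)) (fun t => if t ≤ c then u' t else 0) := by
  refine ⟨hu.nonneg, hu.intervalIntegrable.ite_le c, fun t ht => ?_⟩
  rw [intervalIntegral_ite_le hc.1 ht.1, min_eq_left hc.1]
  exact hu.eq_add_integral _ ⟨le_min ht.1 hc.1, (min_le_left _ _).trans ht.2⟩

namespace LiquidationGame

variable {P : Coefficients} {μ X₁ Y₁ X₂ Y₂ : ℝ → ℝ}

theorem Coefficients.IsAdmissible.intervalIntegrable_κ_mul (hP : P.IsAdmissible)
    (hμ : IntervalIntegrable μ volume 0 P.T) :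
    IntervalIntegrable (fun t => P.κ t * μ t) volume 0 P.T :=
  hμ.continuousOn_mul (by rw [uIcc_of_le hP.T_pos.le]; exact hP.κ_contDiffOn.continuousOn)

theorem isPrimitiveOn_integral_mul_discount (hP : P.IsAdmissible)
    (hμ : IntervalIntegrable μ volume 0 P.T) {φ : ℝ → ℝ} (hφ : ContinuousOn φ (Icc 0 P.T)) :
    IsPrimitiveOn P.T (fun t => ∫ s in (0 : ℝ)..t, P.κ s * μ s * (φ s * discount P s))
      (fun t => P.κ t * μ t * (φ t * discount P t)) := by
  refine .integral hP.T_pos.le ((hP.intervalIntegrable_κ_mul hμ).mul_continuousOn ?_)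
  rw [uIcc_of_le hP.T_pos.le]
  exact hφ.mul (isPrimitiveOn_discount hP).continuousOn

theorem isPrimitiveOn_f (hP : P.IsAdmissible) (hF : IsFundamentalSystem P X₁ Y₁ X₂ Y₂)
    (hμ : IntervalIntegrable μ volume 0 P.T) :
    IsPrimitiveOn P.T (f P μ) (fun t => -(P.κ t * μ t * (X₂ t * discount P t))) := by
  refine (isPrimitiveOn_integral_mul_discount hP hμ hF.snd.fst.continuousOn).neg.congr
    (fun t ht => ?_) fun t ht => rfl
  rw [f, ← intervalIntegral.integral_neg]
  refine intervalIntegral.integral_congr_ae ?_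
  -- The formula for `h` is available only before `T`; the endpoint is a null set.
  filter_upwards [(volume : Measure ℝ).ae_ne P.T] with s hs hst
  rw [uIoc_of_le ht.1] at hst
  rw [h_eq hP hF ⟨hst.1.le, lt_of_le_of_ne (hst.2.trans ht.2) hs⟩]
  ring

theorem f_zero (P : Coefficients) (μ : ℝ → ℝ) : f P μ 0 = 0 := by simp [f]

/-- The second component of the variation of constants. -/
noncomputable def dualIntegral (P : Coefficients) (μ X₁ : ℝ → ℝ) (t : ℝ) : ℝ :=
  ∫ s in (0 : ℝ)..t, P.κ s * μ s * (X₁ s * discount P s)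

/-- The solution formula obtained by variation of constants, applied to the first or to the
second components `Z₁`, `Z₂` of a fundamental system. -/
noncomputable def flow (P : Coefficients) (μ X₁ Z₁ Z₂ : ℝ → ℝ) (x p t : ℝ) : ℝ :=
  (x - f P μ t) * Z₁ t + (p - dualIntegral P μ X₁ t) * Z₂ t

/-- The derivatives of the two coefficients contribute `κ μ · discount · (X₂ X₁ - X₁ X₂) = 0`. -/
theorem isPrimitiveOn_flow_fst (hP : P.IsAdmissible) (hF : IsFundamentalSystem P X₁ Y₁ X₂ Y₂)
    (hμ : IntervalIntegrable μ volume 0 P.T) (x p : ℝ) :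
    IsPrimitiveOn P.T (flow P μ X₁ X₁ X₂ x p) (fun t =>
      -((flow P μ X₁ Y₁ Y₂ x p t - P.δ * P.κ t * flow P μ X₁ X₁ X₂ x p t) / P.η t)) := by
  have hT := hP.T_pos.le
  have h1 := (((IsPrimitiveOn.const hT x).sub (isPrimitiveOn_f hP hF hμ)).mul hF.fst.fst).add
    (((IsPrimitiveOn.const hT p).sub (isPrimitiveOn_integral_mul_discount hP hμ
      hF.fst.fst.continuousOn)).mul hF.snd.fst)
  refine h1.congr (fun t _ => rfl) fun t ht => ?_
  have := hP.η_ne_zero ht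
  simp only [flow, dualIntegral]
  field_simp
  ring

/-- Here the coefficients contribute `-κ μ` times the discounted Wronskian, which is the forcing
term. -/
theorem isPrimitiveOn_flow_snd (hP : P.IsAdmissible) (hF : IsFundamentalSystem P X₁ Y₁ X₂ Y₂)
    (hμ : IntervalIntegrable μ volume 0 P.T) (x p : ℝ) :
    IsPrimitiveOn P.T (flow P μ X₁ Y₁ Y₂ x p) (fun t =>
      -(P.lam t * flow P μ X₁ X₁ X₂ x p t + P.κ t * μ t)) := by
  have hT := hP.T_pos.le
  have h1 := (((IsPrimitiveOn.const hT x).sub (isPrimitiveOn_f hP hF hμ)).mul hF.fst.snd).add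
    (((IsPrimitiveOn.const hT p).sub (isPrimitiveOn_integral_mul_discount hP hμ
      hF.fst.fst.continuousOn)).mul hF.snd.snd)
  refine h1.congr (fun t _ => rfl) fun t ht => ?_
  have := hF.wronskian hP ht
  simp only [flow, dualIntegral]
  linear_combination (P.κ t * μ t) * this

/-- Uniqueness on any initial interval: `(Y₂ X - X₂ Y) · discount + f` and `(X₁ Y - Y₁ X) · discount
+ dualIntegral` are conserved, and the Wronskian inverts this linear system. -/
theorem eq_flow (hP : P.IsAdmissible) (hF : IsFundamentalSystem P X₁ Y₁ X₂ Y₂)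
    (hμ : IntervalIntegrable μ volume 0 P.T) {b : ℝ} (hb : b ∈ Icc 0 P.T) {X Y : ℝ → ℝ}
    (hX : IsPrimitiveOn b X (fun t => -((Y t - P.δ * P.κ t * X t) / P.η t)))
    (hY : IsPrimitiveOn b Y (fun t => -(P.lam t * X t + P.κ t * μ t))) {t : ℝ}
    (ht : t ∈ Icc 0 b) :
    X t = flow P μ X₁ X₁ X₂ (X 0) (Y 0) t ∧ Y t = flow P μ X₁ Y₁ Y₂ (X 0) (Y 0) t := by
  have hsub : Icc 0 b ⊆ Icc 0 P.T := Icc_subset_Icc_right hb.2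
  have hJ := (isPrimitiveOn_discount hP).mono hb
  have h1 := ((((hF.snd.snd.mono hb).mul hX).sub ((hF.snd.fst.mono hb).mul hY)).mul hJ).add
    ((isPrimitiveOn_f hP hF hμ).mono hb)
  have h2 := ((((hF.fst.fst.mono hb).mul hY).sub ((hF.fst.snd.mono hb).mul hX)).mul hJ).add
    ((isPrimitiveOn_integral_mul_discount hP hμ hF.fst.fst.continuousOn).mono hb)
  have h1' := h1.eq_of_deriv_eq_zero (fun s hs => by
    have := hP.η_ne_zero (hsub hs)
    field_simp
    ring) ht
  have h2' := h2.eq_of_deriv_eq_zero (fun s hs => by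
    have := hP.η_ne_zero (hsub hs)
    field_simp
    ring) ht
  simp only [hF.X₁_zero, hF.Y₁_zero, hF.X₂_zero, hF.Y₂_zero, discount_zero, f_zero,
    intervalIntegral.integral_same] at h1' h2'
  have hw := hF.wronskian hP (hsub ht)
  simp only [flow, dualIntegral]
  constructor
  · linear_combination (-X t) * hw + X₁ t * h1' + X₂ t * h2'
  · linear_combination (-Y t) * hw + Y₁ t * h1' + Y₂ t * h2'

section HittingTime

theorem τ_mem (hP : P.IsAdmissible) (μ : ℝ → ℝ) (x : ℝ) : τ P μ x ∈ Icc 0 P.T := by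
  have hlow : ∀ t ∈ insert P.T {t ∈ Icc 0 P.T | f P μ t = x}, 0 ≤ t := by
    rintro t (rfl | ht)
    exacts [hP.T_pos.le, ht.1.1]
  exact ⟨Real.sInf_nonneg hlow, csInf_le ⟨0, hlow⟩ (mem_insert _ _)⟩

theorem τ_le (hP : P.IsAdmissible) {x t : ℝ} (ht : t ∈ Icc 0 P.T) (hx : f P μ t = x) :
    τ P μ x ≤ t := by
  have hlow : ∀ t ∈ insert P.T {t ∈ Icc 0 P.T | f P μ t = x}, 0 ≤ t := by
    rintro t (rfl | ht)
    exacts [hP.T_pos.le, ht.1.1]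
  exact csInf_le ⟨0, hlow⟩ (mem_insert_of_mem _ ⟨ht, hx⟩)

theorem τ_eq_or (hP : P.IsAdmissible) (hf : ContinuousOn (f P μ) (Icc 0 P.T)) (x : ℝ) :
    τ P μ x = P.T ∨ f P μ (τ P μ x) = x := by
  have hlow : ∀ t ∈ insert P.T {t ∈ Icc 0 P.T | f P μ t = x}, 0 ≤ t := by
    rintro t (rfl | ht)
    exacts [hP.T_pos.le, ht.1.1]
  have hclosed : IsClosed (insert P.T {t ∈ Icc 0 P.T | f P μ t = x}) :=
    insert_eq P.T _ ▸ isClosed_singleton.union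
      (hf.preimage_isClosed_of_isClosed isClosed_Icc isClosed_singleton)
  rcases hclosed.csInf_mem ⟨_, mem_insert _ _⟩ ⟨0, hlow⟩ with h | h
  exacts [.inl h, .inr h.2]

theorem τ_pos (hP : P.IsAdmissible) (hf : ContinuousOn (f P μ) (Icc 0 P.T)) {x : ℝ}
    (hx : x ≠ 0) : 0 < τ P μ x := by
  refine (τ_mem hP μ x).1.lt_of_ne fun h0 => ?_
  rcases τ_eq_or hP hf x with h | h
  · exact hP.T_pos.ne (h0.trans h)
  · rw [← h0, f_zero] at h
    exact hx h.symm

/-- The half-open interval is essential: a level first hit at `s` itself has `τ = s` and still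
counts as active. -/
theorem le_τ_iff (hP : P.IsAdmissible) (hf : ContinuousOn (f P μ) (Icc 0 P.T)) {s x : ℝ}
    (hs : s ≤ P.T) : s ≤ τ P μ x ↔ x ∉ f P μ '' Ico 0 s := by
  constructor
  · rintro h ⟨t, ht, htx⟩
    exact absurd (h.trans (τ_le hP ⟨ht.1, ht.2.le.trans hs⟩ htx)) (not_le.2 ht.2)
  · intro h
    by_contra! hlt
    rcases τ_eq_or hP hf x with h1 | h1
    · exact absurd (h1 ▸ hlt) (not_lt.2 hs)
    · exact h ⟨_, ⟨(τ_mem hP μ x).1, hlt⟩, h1⟩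

/-- For `s ≤ T` the superlevel set is the complement of a continuous image of an interval, again an
interval. -/
theorem measurable_τ (hP : P.IsAdmissible) (hf : ContinuousOn (f P μ) (Icc 0 P.T)) :
    Measurable (τ P μ) := by
  refine measurable_of_Ici fun s => ?_
  rcases le_or_gt s P.T with hs | hs
  · have : τ P μ ⁻¹' Ici s = (f P μ '' Ico 0 s)ᶜ := by
      ext x
      exact le_τ_iff hP hf hs
    rw [this]
    refine (OrdConnected.measurableSet ?_).compl
    exact (isPreconnected_Ico.image _ (hf.mono fun t ht => ⟨ht.1, ht.2.le.trans hs⟩)).ordConnected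
  · have : τ P μ ⁻¹' Ici s = ∅ := by
      ext x
      simpa using (τ_mem hP μ x).2.trans_lt hs
    rw [this]
    exact .empty

end HittingTime

/-- The initial costate for which the solution formula vanishes at the liquidation time. -/
noncomputable def initialCostate (P : Coefficients) (μ X₁ X₂ : ℝ → ℝ) (x : ℝ) : ℝ :=
  dualIntegral P μ X₁ (τ P μ x) + (x - f P μ (τ P μ x)) * (-X₁ P.T / X₂ P.T)

/-- One formula serves both cases: either `τ = T`, or the coefficient `x - f τ` vanishes.
Solvability for `p` needs `X₂ τ ≠ 0`, hence `τ > 0`, hence `x ≠ 0`. -/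
theorem flow_fst_τ_eq_zero_iff (hP : P.IsAdmissible)
    (hF : IsFundamentalSystem P X₁ Y₁ X₂ Y₂) (hf : ContinuousOn (f P μ) (Icc 0 P.T)) {x : ℝ}
    (hx : x ≠ 0) {p : ℝ} :
    flow P μ X₁ X₁ X₂ x p (τ P μ x) = 0 ↔ p = initialCostate P μ X₁ X₂ x := by
  have hτ := (hF.X₂_neg hP ⟨τ_pos hP hf hx, (τ_mem hP μ x).2⟩).ne
  have hT := (hF.X₂_neg hP ⟨hP.T_pos, le_rfl⟩).ne
  have key : flow P μ X₁ X₁ X₂ x p (τ P μ x) =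
      (p - initialCostate P μ X₁ X₂ x) * X₂ (τ P μ x) := by
    simp only [flow, initialCostate]
    rcases τ_eq_or hP hf x with h | h
    · rw [h]
      field_simp
      ring
    · rw [h]
      ring
  rw [key, mul_eq_zero, or_iff_left hτ, sub_eq_zero]

theorem isForwardBackwardSolution_flow (hP : P.IsAdmissible)
    (hF : IsFundamentalSystem P X₁ Y₁ X₂ Y₂) (hμ : IntervalIntegrable μ volume 0 P.T) {x : ℝ}
    (hx : x ≠ 0) :
    IsForwardBackwardSolution P μ x
      (fun t => flow P μ X₁ X₁ X₂ x (initialCostate P μ X₁ X₂ x) (min t (τ P μ x)))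
      (fun t => flow P μ X₁ Y₁ Y₂ x (initialCostate P μ X₁ X₂ x) (min t (τ P μ x))) := by
  have hf := (isPrimitiveOn_f hP hF hμ).continuousOn
  have hτ := τ_mem hP μ x
  have hX := (isPrimitiveOn_flow_fst hP hF hμ x (initialCostate P μ X₁ X₂ x)).stopped hτ
  have hY := (isPrimitiveOn_flow_snd hP hF hμ x (initialCostate P μ X₁ X₂ x)).stopped hτ
  refine ⟨hX.continuousOn, hY.continuousOn, fun t ht => ?_, fun t ht => ?_, ?_⟩
  · rw [hX.eq_add_integral t ht, sub_eq_add_neg, ← intervalIntegral.integral_neg]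
    congr 1
    · simp [flow, hτ.1, f_zero, dualIntegral, hF.X₁_zero, hF.X₂_zero]
    · refine intervalIntegral.integral_congr fun s _ => ?_
      by_cases hs : s ≤ τ P μ x <;> simp [hs]
  · rw [← sub_eq_iff_eq_add', ← neg_sub, ← hY.integral_eq_sub ht hP.T_mem,
      ← intervalIntegral.integral_neg]
    refine intervalIntegral.integral_congr fun s _ => ?_
    by_cases hs : s ≤ τ P μ x <;> simp [hs]
  · simp only [min_eq_right hτ.2]
    exact (flow_fst_τ_eq_zero_iff hP hF hf hx).2 rfl

theorem IsForwardBackwardSolution.eq_flow (hP : P.IsAdmissible)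
    (hF : IsFundamentalSystem P X₁ Y₁ X₂ Y₂) (hμ : IntervalIntegrable μ volume 0 P.T) {x : ℝ}
    (hx : x ≠ 0) {X Y : ℝ → ℝ} (h : IsForwardBackwardSolution P μ x X Y) {t : ℝ}
    (ht : t ∈ Icc 0 P.T) :
    X t = flow P μ X₁ X₁ X₂ x (initialCostate P μ X₁ X₂ x) (min t (τ P μ x)) ∧
      Y t = flow P μ X₁ Y₁ Y₂ x (initialCostate P μ X₁ X₂ x) (min t (τ P μ x)) := by
  have hf := (isPrimitiveOn_f hP hF hμ).continuousOn
  have hT := hP.T_pos.le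
  have hτ := τ_mem hP μ x
  have hφ : IntervalIntegrable (fun s => (Y s - P.δ * P.κ s * X s) / P.η s) volume 0 P.T :=
    ((h.continuousOn_Y.sub ((hP.κ_contDiffOn.continuousOn.const_smul P.δ).mul
      h.continuousOn_X)).div hP.η_contDiffOn.continuousOn
        fun t ht => hP.η_ne_zero ht).intervalIntegrable_of_Icc hT
  have hψ : IntervalIntegrable (fun s => P.lam s * X s + P.κ s * μ s) volume 0 P.T :=
    (hP.intervalIntegrable_lam.mul_continuousOn
      (by rw [uIcc_of_le hT]; exact h.continuousOn_X)).add (hP.intervalIntegrable_κ_mul hμ)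
  have hX0 : X 0 = x := by simpa using h.forward 0 hP.zero_mem
  have hX : ∀ t ∈ Icc 0 P.T, X t = x - ∫ s in (0 : ℝ)..min t (τ P μ x),
      (Y s - P.δ * P.κ s * X s) / P.η s := fun t ht => by
    rw [h.forward t ht, intervalIntegral_ite_le hτ.1 ht.1]
  have hY : ∀ t ∈ Icc 0 P.T, Y t = Y 0 - ∫ s in (0 : ℝ)..min t (τ P μ x),
      (P.lam s * X s + P.κ s * μ s) := fun t ht => by
    have h1 := (IsPrimitiveOn.integral hT (hψ.ite_le (τ P μ x))).integral_eq_sub ht hP.T_mem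
    have h2 := h.backward t ht
    have h3 := h.backward 0 hP.zero_mem
    rw [← intervalIntegral_ite_le (φ := fun s => P.lam s * X s + P.κ s * μ s) hτ.1 ht.1]
    linarith
  have hX' : IsPrimitiveOn (τ P μ x) X (fun t => -((Y t - P.δ * P.κ t * X t) / P.η t)) := by
    refine ((IsPrimitiveOn.const hT x).sub (.integral hT hφ)).mono hτ |>.congr
      (fun t ht => ?_) fun t _ => by ring
    rw [hX t ⟨ht.1, ht.2.trans hτ.2⟩, min_eq_left ht.2]
  have hY' : IsPrimitiveOn (τ P μ x) Y (fun t => -(P.lam t * X t + P.κ t * μ t)) := by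
    refine ((IsPrimitiveOn.const hT (Y 0)).sub (.integral hT hψ)).mono hτ |>.congr
      (fun t ht => ?_) fun t _ => by ring
    rw [hY t ⟨ht.1, ht.2.trans hτ.2⟩, min_eq_left ht.2]
  have hmin : ∀ t ∈ Icc 0 P.T, min t (τ P μ x) ∈ Icc 0 (τ P μ x) := fun t ht =>
    ⟨le_min ht.1 hτ.1, min_le_right _ _⟩
  have hXmin : ∀ t ∈ Icc 0 P.T, X t = X (min t (τ P μ x)) := fun t ht => by
    have h1 := hmin t ht
    rw [hX t ht, hX _ ⟨h1.1, h1.2.trans hτ.2⟩, min_assoc, min_self]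
  have hYmin : Y t = Y (min t (τ P μ x)) := by
    have h1 := hmin t ht
    rw [hY t ht, hY _ ⟨h1.1, h1.2.trans hτ.2⟩, min_assoc, min_self]
  -- The solution is constant after `τ`, so `X T = 0` gives `X τ = 0`, which fixes the initial
  -- costate.
  have hp : Y 0 = initialCostate P μ X₁ X₂ x := by
    rw [← flow_fst_τ_eq_zero_iff hP hF hf hx]
    have h1 := (LiquidationGame.eq_flow hP hF hμ hτ hX' hY' ⟨hτ.1, le_rfl⟩).1
    have h2 := hXmin P.T hP.T_mem
    rw [min_eq_right hτ.2, h.terminal] at h2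
    rw [hX0] at h1
    rw [← h1, h2]
  have h1 := LiquidationGame.eq_flow hP hF hμ hτ hX' hY' (hmin t ht)
  rw [hX0, hp] at h1
  exact ⟨(hXmin t ht).trans h1.1, hYmin.trans h1.2⟩

theorem isForwardBackwardSolution_state (hP : P.IsAdmissible)
    (hμ : IntervalIntegrable μ volume 0 P.T) {x : ℝ} (hx : x ≠ 0) :
    IsForwardBackwardSolution P μ x (state P μ x).1 (state P μ x).2 := by
  obtain ⟨X₁, Y₁, X₂, Y₂, hF⟩ := exists_isFundamentalSystem hP
  exact Classical.epsilon_spec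
    (p := fun p : (ℝ → ℝ) × (ℝ → ℝ) => IsForwardBackwardSolution P μ x p.1 p.2)
    ⟨(_, _), isForwardBackwardSolution_flow hP hF hμ hx⟩

end LiquidationGame

/-! ### Linear growth and Fubini -/

/-- A measurable function of two variables which grows at most linearly in the first one,
uniformly in the second one. -/
structure HasLinearGrowth (g : ℝ × ℝ → ℝ) : Prop where
  measurable : Measurable g
  exists_bound : ∃ C, ∀ z, |g z| ≤ C * (1 + |z.1|)

/-- A bounded measurable function. -/
structure IsBoundedMeasurable (g : ℝ × ℝ → ℝ) : Prop where
  measurable : Measurable g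
  exists_bound : ∃ C, ∀ z, |g z| ≤ C

theorem HasLinearGrowth.fst : HasLinearGrowth (fun z => z.1) :=
  ⟨measurable_fst, 1, fun z => by linarith [abs_nonneg z.1]⟩

theorem IsBoundedMeasurable.hasLinearGrowth {g : ℝ × ℝ → ℝ} (hg : IsBoundedMeasurable g) :
    HasLinearGrowth g := by
  obtain ⟨C, hC⟩ := hg.exists_bound
  refine ⟨hg.measurable, C, fun z => (hC z).trans ?_⟩
  nlinarith [(abs_nonneg _).trans (hC z), abs_nonneg z.1]

namespace HasLinearGrowth

variable {g k : ℝ × ℝ → ℝ}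

theorem add (hg : HasLinearGrowth g) (hk : HasLinearGrowth k) :
    HasLinearGrowth (fun z => g z + k z) := by
  obtain ⟨C, hC⟩ := hg.exists_bound
  obtain ⟨D, hD⟩ := hk.exists_bound
  refine ⟨hg.measurable.add hk.measurable, C + D, fun z => ?_⟩
  linarith [abs_add_le (g z) (k z), hC z, hD z]

theorem mul (hg : HasLinearGrowth g) (hk : IsBoundedMeasurable k) :
    HasLinearGrowth (fun z => g z * k z) := by
  obtain ⟨C, hC⟩ := hg.exists_bound
  obtain ⟨D, hD⟩ := hk.exists_bound
  refine ⟨hg.measurable.mul hk.measurable, C * D, fun z => ?_⟩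
  rw [abs_mul]
  calc |g z| * |k z| ≤ (C * (1 + |z.1|)) * D :=
        mul_le_mul (hC z) (hD z) (abs_nonneg _) ((abs_nonneg _).trans (hC z))
    _ = C * D * (1 + |z.1|) := by ring

theorem neg (hg : HasLinearGrowth g) : HasLinearGrowth (fun z => -g z) := by
  obtain ⟨C, hC⟩ := hg.exists_bound
  exact ⟨hg.measurable.neg, C, fun z => by simpa using hC z⟩

theorem sub (hg : HasLinearGrowth g) (hk : HasLinearGrowth k) :
    HasLinearGrowth (fun z => g z - k z) := by
  simpa [sub_eq_add_neg] using hg.add hk.neg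

theorem integrable {ν : Measure ℝ} [IsProbabilityMeasure ν] (hν : Integrable (fun x : ℝ => x) ν)
    (hg : HasLinearGrowth g) (s : ℝ) : Integrable (fun x => g (x, s)) ν := by
  obtain ⟨C, hC⟩ := hg.exists_bound
  exact (((integrable_const (1 : ℝ)).add hν.abs).const_mul C).mono'
    (hg.measurable.comp measurable_prodMk_right).aestronglyMeasurable
    (.of_forall fun x => hC (x, s))

theorem intervalIntegrable_mul {a b : ℝ} {K : ℝ → ℝ} (hK : IntervalIntegrable K volume a b)
    (hg : HasLinearGrowth g) (x : ℝ) :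
    IntervalIntegrable (fun s => K s * g (x, s)) volume a b := by
  obtain ⟨C, hC⟩ := hg.exists_bound
  rw [intervalIntegrable_iff] at hK ⊢
  exact hK.mul_bdd (hg.measurable.comp measurable_prodMk_left).aestronglyMeasurable
    (c := C * (1 + |x|)) (.of_forall fun s => hC (x, s))

theorem integrable_prod {ν : Measure ℝ} [IsProbabilityMeasure ν]
    (hν : Integrable (fun x : ℝ => x) ν) {a b : ℝ} {K : ℝ → ℝ}
    (hK : IntervalIntegrable K volume a b) (hg : HasLinearGrowth g) :
    Integrable (Function.uncurry fun s x => K s * g (x, s))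
      ((volume.restrict (uIoc a b)).prod ν) := by
  obtain ⟨C, hC⟩ := hg.exists_bound
  rw [intervalIntegrable_iff] at hK
  have hx : Integrable (fun x : ℝ => C * (1 + |x|)) ν :=
    ((integrable_const (1 : ℝ)).add hν.abs).const_mul C
  refine (hK.norm.mul_prod hx).mono' ?_ (.of_forall fun z => ?_)
  · exact hK.aestronglyMeasurable.comp_fst.mul
      (hg.measurable.comp measurable_swap).aestronglyMeasurable
  · simp only [Function.uncurry, norm_mul]
    exact mul_le_mul_of_nonneg_left (hC (z.2, z.1)) (norm_nonneg _)

theorem integrable_intervalIntegral {ν : Measure ℝ} [IsProbabilityMeasure ν]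
    (hν : Integrable (fun x : ℝ => x) ν) {a b : ℝ} {K : ℝ → ℝ}
    (hK : IntervalIntegrable K volume a b) (hg : HasLinearGrowth g) :
    Integrable (fun x => ∫ s in a..b, K s * g (x, s)) ν := by
  have h := (hg.integrable_prod hν hK).integral_prod_right
  simp only [Function.uncurry] at h
  simp only [intervalIntegral.intervalIntegral_eq_integral_uIoc]
  exact h.const_mul _

theorem intervalIntegrable_integral {ν : Measure ℝ} [IsProbabilityMeasure ν]
    (hν : Integrable (fun x : ℝ => x) ν) {a b : ℝ} {K : ℝ → ℝ}
    (hK : IntervalIntegrable K volume a b) (hg : HasLinearGrowth g) :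
    IntervalIntegrable (fun s => K s * ∫ x, g (x, s) ∂ν) volume a b := by
  have h := (hg.integrable_prod hν hK).integral_prod_left
  simp only [Function.uncurry, integral_const_mul] at h
  exact intervalIntegrable_iff.2 h

theorem integral_intervalIntegral {ν : Measure ℝ} [IsProbabilityMeasure ν]
    (hν : Integrable (fun x : ℝ => x) ν) {a b : ℝ} {K : ℝ → ℝ}
    (hK : IntervalIntegrable K volume a b) (hg : HasLinearGrowth g) :
    ∫ x, (∫ s in a..b, K s * g (x, s)) ∂ν = ∫ s in a..b, K s * ∫ x, g (x, s) ∂ν := by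
  rw [← intervalIntegral_integral_swap (hg.integrable_prod hν hK)]
  simp only [integral_const_mul]

end HasLinearGrowth

theorem IsBoundedMeasurable.comp_of_continuousOn {b : ℝ} (hb : 0 ≤ b) {φ : ℝ → ℝ}
    (hφ : ContinuousOn φ (Icc 0 b)) {θ : ℝ × ℝ → ℝ} (hθ : Measurable θ) :
    IsBoundedMeasurable (fun z => φ (projIcc 0 b hb (θ z))) := by
  have hc : Continuous (fun t => φ (projIcc 0 b hb t)) :=
    hφ.comp_continuous (by fun_prop) fun t => (projIcc 0 b hb t).2
  obtain ⟨C, hC⟩ := isCompact_Icc.exists_bound_of_continuousOn hφ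
  exact ⟨hc.measurable.comp hθ, C, fun z => hC _ (projIcc 0 b hb (θ z)).2⟩

theorem IsBoundedMeasurable.const (c : ℝ) : IsBoundedMeasurable (fun _ => c) :=
  ⟨measurable_const, |c|, fun _ => le_rfl⟩

/-! ### The state and the trading rate as functions of position and time -/

namespace LiquidationGame

variable {P : Coefficients} {μ : ℝ → ℝ}

/-- Stopping before `T` means `f τ = x`, so both coefficients of the flow vanish at `τ`.
Consequently the indicator can be dropped from every term except `κ μ`. -/
theorem state_eq_zero (hP : P.IsAdmissible) (hμ : IntervalIntegrable μ volume 0 P.T) {x : ℝ}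
    (hx : x ≠ 0) {t : ℝ} (ht : t ∈ Icc 0 P.T) (hτ : τ P μ x < t) :
    (state P μ x).1 t = 0 ∧ (state P μ x).2 t = 0 := by
  obtain ⟨X₁, Y₁, X₂, Y₂, hF⟩ := exists_isFundamentalSystem hP
  obtain ⟨h1, h2⟩ := (isForwardBackwardSolution_state hP hμ hx).eq_flow hP hF hμ hx ht
  have h3 : f P μ (τ P μ x) = x :=
    (τ_eq_or hP (isPrimitiveOn_f hP hF hμ).continuousOn x).resolve_left
      (hτ.trans_le ht.2).ne
  rw [h1, h2, min_eq_right hτ.le]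
  simp [flow, initialCostate, h3]

theorem isPrimitiveOn_state_fst (hP : P.IsAdmissible) (hμ : IntervalIntegrable μ volume 0 P.T)
    {x : ℝ} (hx : x ≠ 0) : IsPrimitiveOn P.T (state P μ x).1 (fun t => -ξ P μ x t) := by
  obtain ⟨X₁, Y₁, X₂, Y₂, hF⟩ := exists_isFundamentalSystem hP
  have h := fun t ht => (isForwardBackwardSolution_state hP hμ hx).eq_flow hP hF hμ hx (t := t) ht
  refine ((isPrimitiveOn_flow_fst hP hF hμ x (initialCostate P μ X₁ X₂ x)).stopped
    (τ_mem hP μ x)).congr (fun t ht => (h t ht).1) fun t ht => ?_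
  by_cases hτ : t ≤ τ P μ x
  · rw [if_pos hτ, ξ, (h t ht).1, (h t ht).2, min_eq_left hτ]
  · have h0 := state_eq_zero hP hμ hx ht (not_le.1 hτ)
    simp [hτ, ξ, h0.1, h0.2]

theorem isPrimitiveOn_state_snd (hP : P.IsAdmissible) (hμ : IntervalIntegrable μ volume 0 P.T)
    {x : ℝ} (hx : x ≠ 0) :
    IsPrimitiveOn P.T (state P μ x).2 (fun t =>
      -(P.lam t * (state P μ x).1 t + P.κ t * μ t * if t ≤ τ P μ x then 1 else 0)) := by
  obtain ⟨X₁, Y₁, X₂, Y₂, hF⟩ := exists_isFundamentalSystem hP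
  have h := fun t ht => (isForwardBackwardSolution_state hP hμ hx).eq_flow hP hF hμ hx (t := t) ht
  refine ((isPrimitiveOn_flow_snd hP hF hμ x (initialCostate P μ X₁ X₂ x)).stopped
    (τ_mem hP μ x)).congr (fun t ht => (h t ht).2) fun t ht => ?_
  by_cases hτ : t ≤ τ P μ x
  · rw [if_pos hτ, if_pos hτ, (h t ht).1, min_eq_left hτ, mul_one]
  · have h0 := state_eq_zero hP hμ hx ht (not_le.1 hτ)
    simp [hτ, h0.1]

theorem state_fst_eq_integral (hP : P.IsAdmissible) (hμ : IntervalIntegrable μ volume 0 P.T)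
    {x : ℝ} (hx : x ≠ 0) {t : ℝ} (ht : t ∈ Icc 0 P.T) :
    (state P μ x).1 t = ∫ s in t..P.T, ξ P μ x s := by
  have h := (isPrimitiveOn_state_fst hP hμ hx).integral_eq_sub ht hP.T_mem
  rw [(isForwardBackwardSolution_state hP hμ hx).terminal, intervalIntegral.integral_neg] at h
  linarith

theorem isPrimitiveOn_ξ (hP : P.IsAdmissible) (hμ : IntervalIntegrable μ volume 0 P.T)
    {x : ℝ} (hx : x ≠ 0) :
    IsPrimitiveOn P.T (ξ P μ x) (fun t =>
      -(P.κ t / P.η t * μ t * (if t ≤ τ P μ x then 1 else 0) +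
        (P.lam t + P.δ * P.κ' t) / P.η t * (state P μ x).1 t +
        (P.η' t - P.δ * P.κ t) / P.η t * ξ P μ x t)) := by
  have hη : IsPrimitiveOn P.T P.η P.η' := .of_contDiffOn hP.T_pos hP.η_contDiffOn
  have hη' : ContinuousOn P.η' (Icc 0 P.T) :=
    hP.η_contDiffOn.continuousOn_derivWithin (uniqueDiffOn_Icc hP.T_pos) le_rfl
  have hκ : IsPrimitiveOn P.T P.κ P.κ' := .of_contDiffOn hP.T_pos hP.κ_contDiffOn
  have h := ((isPrimitiveOn_state_snd hP hμ hx).sub ((hκ.const_mul P.δ).mul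
    (isPrimitiveOn_state_fst hP hμ hx))).mul (hη.inv hη' fun t ht => hP.η_ne_zero ht)
  refine h.congr (fun t _ => ?_) fun t ht => ?_
  · rw [ξ, div_eq_mul_inv]
  · have := hP.η_ne_zero ht
    simp only [ξ]
    field_simp
    ring

/-- The states are chosen separately for each `x`, so joint measurability must be read off the
explicit formula. The value `x = 0` is excluded: there `τ = 0` and `Y` may be any constant. -/
theorem exists_hasLinearGrowth_state (hP : P.IsAdmissible)
    (hμ : IntervalIntegrable μ volume 0 P.T) :
    ∃ gX gξ : ℝ × ℝ → ℝ, HasLinearGrowth gX ∧ HasLinearGrowth gξ ∧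
      ∀ x ≠ 0, ∀ t ∈ Icc 0 P.T, (state P μ x).1 t = gX (x, t) ∧ ξ P μ x t = gξ (x, t) := by
  obtain ⟨X₁, Y₁, X₂, Y₂, hF⟩ := exists_isFundamentalSystem hP
  have hT := hP.T_pos.le
  have hf := (isPrimitiveOn_f hP hF hμ).continuousOn
  have he : ContinuousOn (dualIntegral P μ X₁) (Icc 0 P.T) :=
    (isPrimitiveOn_integral_mul_discount hP hμ hF.fst.fst.continuousOn).continuousOn
  have hτm : Measurable (fun z : ℝ × ℝ => τ P μ z.1) := (measurable_τ hP hf).comp measurable_fst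
  have hτt : Measurable (fun z : ℝ × ℝ => min z.2 (τ P μ z.1)) := measurable_snd.min hτm
  have hp := (IsBoundedMeasurable.comp_of_continuousOn hT he hτm).hasLinearGrowth.add
    ((HasLinearGrowth.fst.sub
      (IsBoundedMeasurable.comp_of_continuousOn hT hf hτm).hasLinearGrowth).mul
        (.const (-X₁ P.T / X₂ P.T)))
  have hflow := fun {Z₁ Z₂ : ℝ → ℝ} (h₁ : ContinuousOn Z₁ (Icc 0 P.T))
      (h₂ : ContinuousOn Z₂ (Icc 0 P.T)) =>
    ((HasLinearGrowth.fst.sub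
      (IsBoundedMeasurable.comp_of_continuousOn hT hf hτt).hasLinearGrowth).mul
        (.comp_of_continuousOn hT h₁ hτt)).add
    ((hp.sub (IsBoundedMeasurable.comp_of_continuousOn hT he hτt).hasLinearGrowth).mul
      (.comp_of_continuousOn hT h₂ hτt))
  have hgX := hflow hF.fst.fst.continuousOn hF.snd.fst.continuousOn
  have hgY := hflow hF.fst.snd.continuousOn hF.snd.snd.continuousOn
  have hgξ := (hgY.sub (hgX.mul (.comp_of_continuousOn hT
    (hP.κ_contDiffOn.continuousOn.const_smul P.δ) measurable_snd))).mul (.comp_of_continuousOn hT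
    (hP.η_contDiffOn.continuousOn.inv₀ fun t ht => hP.η_ne_zero ht) measurable_snd)
  refine ⟨_, _, hgX, hgξ, fun x hx t ht => ?_⟩
  obtain ⟨h1, h2⟩ := (isForwardBackwardSolution_state hP hμ hx).eq_flow hP hF hμ hx ht
  have hτ := τ_mem hP μ x
  have hmin : min t (τ P μ x) ∈ Icc 0 P.T := ⟨le_min ht.1 hτ.1, (min_le_left _ _).trans ht.2⟩
  simp only [ξ, h1, h2, flow, initialCostate, projIcc_of_mem hT hmin, projIcc_of_mem hT hτ,
    projIcc_of_mem hT ht, true_and, Pi.smul_apply, smul_eq_mul, Pi.inv_apply]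
  ring

end LiquidationGame

/-! ### Terminal value problems and Gronwall estimates -/

theorem IsPrimitiveOn.of_eq_terminal_add {b : ℝ} (hb : 0 ≤ b) {u d : ℝ → ℝ}
    (hd : IntervalIntegrable d volume 0 b) (h : ∀ t ∈ Icc 0 b, u t = u b + ∫ s in t..b, d s) :
    IsPrimitiveOn b u (fun s => -d s) := by
  refine ⟨hb, hd.neg, fun t ht => ?_⟩
  have h1 := (IsPrimitiveOn.integral hb hd).integral_eq_sub ht ⟨hb, le_rfl⟩
  rw [intervalIntegral.integral_neg]
  linarith [h t ht, h 0 ⟨le_rfl, hb⟩]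

theorem IsPrimitiveOn.eq_terminal_add {b : ℝ} {u d : ℝ → ℝ}
    (h : IsPrimitiveOn b u (fun s => -d s)) {t : ℝ} (ht : t ∈ Icc 0 b) :
    u t = u b + ∫ s in t..b, d s := by
  have := h.integral_eq_sub ht ⟨h.nonneg, le_rfl⟩
  rw [intervalIntegral.integral_neg] at this
  linarith

theorem integral_add_add_add {α : Type*} [MeasurableSpace α] {ν : Measure α} {u v w z : α → ℝ}
    (hu : Integrable u ν) (hv : Integrable v ν) (hw : Integrable w ν) (hz : Integrable z ν) :
    ∫ x, (u x + (v x + w x + z x)) ∂ν =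
      (∫ x, u x ∂ν) + ((∫ x, v x ∂ν) + (∫ x, w x ∂ν) + ∫ x, z x ∂ν) := by
  have h1 : Integrable (fun x => v x + w x) ν := hv.add hw
  have h2 : Integrable (fun x => v x + w x + z x) ν := h1.add hz
  rw [integral_add hu h2, integral_add h1 hz, integral_add hv hw]

section Gronwall

theorem eq_zero_of_abs_le_mul_integral {u : ℝ → ℝ} {a b C : ℝ} (hu : ContinuousOn u (Icc a b))
    (h : ∀ t ∈ Icc a b, |u t| ≤ C * ∫ s in a..t, |u s|) {t : ℝ} (ht : t ∈ Icc a b) :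
    u t = 0 := by
  have hab : a ≤ b := ht.1.trans ht.2
  have hc : Continuous (fun t => |u (projIcc a b hab t)|) :=
    (hu.comp_continuous (by fun_prop) fun t => (projIcc a b hab t).2).abs
  have heq : ∀ t ∈ Icc a b, ∫ s in a..t, |u s| = ∫ s in a..t, |u (projIcc a b hab s)| :=
    fun t ht => intervalIntegral.integral_congr fun s hs => by
      rw [uIcc_of_le ht.1] at hs
      simp only [projIcc_of_mem hab ⟨hs.1, hs.2.trans ht.2⟩]
  have hd := fun t => (hc.integral_hasStrictDerivAt a t).hasDerivAt
  have h0 := norm_le_gronwallBound_of_norm_deriv_right_le (δ := 0) (K := C) (ε := 0)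
    (fun t _ => (hd t).continuousAt.continuousWithinAt)
    (fun t _ => (hd t).hasDerivWithinAt) (by simp) (fun t ht' => by
      have ht'' := Ico_subset_Icc_self ht'
      have h1 := h t ht''
      rw [heq t ht''] at h1
      have h2 : 0 ≤ ∫ s in a..t, |u (projIcc a b hab s)| :=
        intervalIntegral.integral_nonneg ht'.1 fun _ _ => abs_nonneg _
      simpa [projIcc_of_mem hab ht'', abs_of_nonneg h2] using h1) t ht
  rw [gronwallBound_ε0_δ0, norm_le_zero_iff, ← heq t ht] at h0
  have h1 := h t ht
  rw [h0, mul_zero] at h1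
  exact abs_nonpos_iff.1 h1

theorem eq_zero_of_abs_le_mul_integral_right {u : ℝ → ℝ} {a b C : ℝ}
    (hu : ContinuousOn u (Icc a b)) (h : ∀ t ∈ Icc a b, |u t| ≤ C * ∫ s in t..b, |u s|) {t : ℝ}
    (ht : t ∈ Icc a b) : u t = 0 := by
  have hmem : ∀ s ∈ Icc 0 (b - a), b - s ∈ Icc a b := fun s hs =>
    ⟨by linarith [hs.2], by linarith [hs.1]⟩
  have h1 := eq_zero_of_abs_le_mul_integral (u := fun s => u (b - s)) (a := 0) (b := b - a)
    (C := C) (hu.comp (by fun_prop) hmem) (fun s hs => by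
      have := h _ (hmem s hs)
      rwa [intervalIntegral.integral_comp_sub_left (fun s => |u s|), sub_zero])
    (t := b - t) ⟨by linarith [ht.2], by linarith [ht.1]⟩
  simpa using h1

variable {b C D : ℝ} {q θ d : ℝ → ℝ}

/-- A solution of `-q' = θ q + d ∫ₜᵇ q` with bounded coefficients vanishes if `q b = 0`. -/
theorem IsPrimitiveOn.eq_zero_of_terminal_eq_zero
    (hq : IsPrimitiveOn b q (fun s => -(θ s * q s + d s * ∫ u in s..b, q u)))
    (hθ : ∀ᵐ s, s ∈ Icc 0 b → |θ s| ≤ C) (hd : ∀ᵐ s, s ∈ Icc 0 b → |d s| ≤ D)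
    (hqb : q b = 0) {t : ℝ} (ht : t ∈ Icc 0 b) : q t = 0 := by
  have hint : ∀ s ∈ Icc 0 b, IntervalIntegrable (fun u => |q u|) volume s b := fun s hs =>
    (hq.continuousOn.abs.mono (Icc_subset_Icc_left hs.1)).intervalIntegrable_of_Icc hs.2
  -- The inner integral over `[s, b]` is bounded by the one over `[t, b]`; integrating that constant
  -- in `s` costs a factor of at most `b`.
  refine eq_zero_of_abs_le_mul_integral_right (C := |C| + |D| * b) hq.continuousOn
    (fun t ht => ?_) ht
  have h1 := hq.eq_terminal_add ht
  rw [hqb, zero_add] at h1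
  have hI : 0 ≤ ∫ s in t..b, |q s| :=
    intervalIntegral.integral_nonneg ht.2 fun _ _ => abs_nonneg _
  have h2 : |q t| ≤ ∫ s in t..b, (|C| * |q s| + |D| * ∫ u in t..b, |q u|) := by
    rw [h1, ← Real.norm_eq_abs]
    refine intervalIntegral.norm_integral_le_of_norm_le ht.2 ?_
      (((hint t ht).const_mul _).add intervalIntegrable_const)
    filter_upwards [hθ, hd] with s hs1 hs2 hs
    have hs' : s ∈ Icc 0 b := ⟨ht.1.trans hs.1.le, hs.2⟩
    refine (norm_add_le _ _).trans (add_le_add ?_ ?_)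
    · rw [norm_mul]
      exact mul_le_mul_of_nonneg_right ((hs1 hs').trans (le_abs_self C)) (abs_nonneg _)
    · rw [norm_mul]
      refine mul_le_mul ((hs2 hs').trans (le_abs_self D)) ?_ (norm_nonneg _) (abs_nonneg _)
      refine (intervalIntegral.norm_integral_le_integral_norm hs.2).trans ?_
      exact intervalIntegral.integral_mono_interval hs.1.le hs.2 le_rfl
        (.of_forall fun _ => abs_nonneg _) (hint t ht)
  refine h2.trans ?_
  rw [intervalIntegral.integral_add ((hint t ht).const_mul _) intervalIntegrable_const,
    intervalIntegral.integral_const_mul, intervalIntegral.integral_const, smul_eq_mul, add_mul]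
  refine add_le_add le_rfl ?_
  have := mul_nonneg (abs_nonneg D) hI
  nlinarith [mul_nonneg ht.1 this]

/-- A solution of `-q' = θ q + d ∫ₜᵇ q` with `θ` bounded and `d ≥ 0` is positive if `q b > 0`. -/
theorem IsPrimitiveOn.pos_of_terminal_pos
    (hq : IsPrimitiveOn b q (fun s => -(θ s * q s + d s * ∫ u in s..b, q u)))
    (hθ : ∀ᵐ s, s ∈ Icc 0 b → |θ s| ≤ C) (hd : ∀ᵐ s, s ∈ Icc 0 b → 0 ≤ d s)
    (hqb : 0 < q b) {t : ℝ} (ht : t ∈ Icc 0 b) : 0 < q t := by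
  by_contra! hneg
  have hK : IsCompact (Icc 0 b ∩ q ⁻¹' Iic 0) :=
    isCompact_Icc.of_isClosed_subset
      (hq.continuousOn.preimage_isClosed_of_isClosed isClosed_Icc isClosed_Iic) inter_subset_left
  -- Beyond the last point `c` with `q c ≤ 0`, `q` is positive, so the nonlocal term only makes `q`
  -- decrease and no upper bound on `d` is needed. Gronwall from `c` then makes the positive part of
  -- `q` vanish at `b`, a contradiction.
  obtain ⟨c, ⟨hc, hqc⟩, hmax⟩ := hK.exists_isGreatest ⟨t, ht, hneg⟩
  have hpos : ∀ s ∈ Ioc c b, 0 < q s := fun s hs => by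
    by_contra! h0
    exact absurd (hmax ⟨⟨hc.1.trans hs.1.le, hs.2⟩, h0⟩) (not_le.2 hs.1)
  have hcb : c < b := hc.2.lt_of_ne fun h0 => absurd (h0 ▸ hqc : q b ≤ 0) (not_le.2 hqb)
  have hsub : Icc c b ⊆ Icc 0 b := Icc_subset_Icc_left hc.1
  have hu : ContinuousOn (fun s => max (q s) 0) (Icc c b) :=
    (hq.continuousOn.mono hsub).sup continuousOn_const
  have hgoal := eq_zero_of_abs_le_mul_integral (C := C) hu (fun s hs => ?_) (t := b)
    ⟨hcb.le, le_rfl⟩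
  · rw [max_eq_left hqb.le] at hgoal
    exact hqb.ne' hgoal
  rcases hs.1.eq_or_lt with rfl | hcs
  · rw [max_eq_right hqc]
    simp
  rw [abs_of_nonneg (le_max_right _ _), max_eq_left (hpos s ⟨hcs, hs.2⟩).le,
    ← intervalIntegral.integral_const_mul]
  have h1 := hq.integral_eq_sub hc (hsub hs)
  have h2 : ∫ r in c..s, -(θ r * q r + d r * ∫ u in r..b, q u) ≤
      ∫ r in c..s, C * |max (q r) 0| := by
    refine intervalIntegral.integral_mono_ae_restrict hcs.le
      (hq.intervalIntegrable_of_mem hc (hsub hs))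
      ((hu.abs.mono (Icc_subset_Icc_right hs.2)).intervalIntegrable_of_Icc hcs.le |>.const_mul _) ?_
    rw [← Measure.restrict_congr_set Ioc_ae_eq_Icc, EventuallyLE, ae_restrict_iff' measurableSet_Ioc]
    filter_upwards [hθ, hd] with r hr1 hr2 hr
    have hr' : r ∈ Ioc c b := ⟨hr.1, hr.2.trans hs.2⟩
    have hr'' := hsub (Ioc_subset_Icc_self hr')
    have h3 := hpos r hr'
    have h4 : 0 ≤ ∫ u in r..b, q u := by
      refine intervalIntegral.integral_nonneg hr'.2 fun u hu => ?_
      exact (hpos u ⟨hr'.1.trans_le hu.1, hu.2⟩).le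
    rw [max_eq_left h3.le, abs_of_pos h3]
    nlinarith [mul_nonneg (hr2 hr'') h4, mul_le_mul_of_nonneg_right
      ((neg_le_abs (θ r)).trans (hr1 hr'')) h3.le]
  have h5 : q c ≤ 0 := hqc
  linarith

end Gronwall

/-! ### The linear equation satisfied by `F(μ)` -/

namespace LiquidationGame

variable {P : Coefficients} {μ : ℝ → ℝ} {ν₀ : Measure ℝ} [IsProbabilityMeasure ν₀]

namespace Coefficients.IsAdmissible

theorem continuousOn_κ_div_η (hP : P.IsAdmissible) :
    ContinuousOn (fun t => P.κ t / P.η t) (Icc 0 P.T) :=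
  hP.κ_contDiffOn.continuousOn.div hP.η_contDiffOn.continuousOn fun _ ht => hP.η_ne_zero ht

theorem continuousOn_η'_sub_div_η (hP : P.IsAdmissible) :
    ContinuousOn (fun t => (P.η' t - P.δ * P.κ t) / P.η t) (Icc 0 P.T) :=
  ((hP.η_contDiffOn.continuousOn_derivWithin (uniqueDiffOn_Icc hP.T_pos) le_rfl).sub
    (hP.κ_contDiffOn.continuousOn.const_smul P.δ)).div hP.η_contDiffOn.continuousOn
      fun _ ht => hP.η_ne_zero ht

theorem continuousOn_κ' (hP : P.IsAdmissible) : ContinuousOn P.κ' (Icc 0 P.T) :=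
  hP.κ_contDiffOn.continuousOn_derivWithin (uniqueDiffOn_Icc hP.T_pos) le_rfl

theorem intervalIntegrable_cost (hP : P.IsAdmissible) :
    IntervalIntegrable (fun t => (P.lam t + P.δ * P.κ' t) / P.η t) volume 0 P.T := by
  have h := uIcc_of_le hP.T_pos.le
  refine ((hP.intervalIntegrable_lam.add ((hP.continuousOn_κ'.intervalIntegrable_of_Icc
    hP.T_pos.le).const_mul P.δ)).mul_continuousOn (g := fun t => (P.η t)⁻¹) ?_)
  rw [h]
  exact hP.η_contDiffOn.continuousOn.inv₀ fun t ht => hP.η_ne_zero ht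

theorem exists_cost_bound (hP : P.IsAdmissible) :
    ∃ D, ∀ᵐ t, t ∈ Icc 0 P.T → |(P.lam t + P.δ * P.κ' t) / P.η t| ≤ D := by
  obtain ⟨C, hC0, hC⟩ := hP.exists_lam_bound
  obtain ⟨B, hB⟩ := isCompact_Icc.exists_bound_of_continuousOn
    (hP.continuousOn_κ'.const_smul P.δ)
  obtain ⟨E, hE⟩ := isCompact_Icc.exists_bound_of_continuousOn
    (hP.η_contDiffOn.continuousOn.inv₀ fun t ht => hP.η_ne_zero ht)
  refine ⟨(C + B) * E, ?_⟩
  filter_upwards [hC] with t h1 ht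
  rw [div_eq_mul_inv, abs_mul]
  exact mul_le_mul ((abs_add_le _ _).trans (add_le_add (h1 ht) (hB t ht))) (hE t ht)
    (abs_nonneg _) (add_nonneg hC0 ((norm_nonneg _).trans (hB t ht)))

end Coefficients.IsAdmissible

/-- The right-hand side of the integral equation for the mean trading rate `q`, with
participation rate `ρ` and feedback `m`. -/
noncomputable def meanDrift (P : Coefficients) (ρ m q : ℝ → ℝ) (s : ℝ) : ℝ :=
  P.κ s / P.η s * m s * ρ s + (P.lam s + P.δ * P.κ' s) / P.η s * (∫ u in s..P.T, q u) +
    (P.η' s - P.δ * P.κ s) / P.η s * q s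

/-- The proportion of players who have not liquidated before `s`. -/
noncomputable def participation (P : Coefficients) (ν₀ : Measure ℝ) (μ : ℝ → ℝ) (s : ℝ) : ℝ :=
  ν₀.real {x | s ≤ τ P μ x}

theorem integrable_ξ (hP : P.IsAdmissible) (hμ : IntervalIntegrable μ volume 0 P.T)
    (hν₀ : Integrable (fun x : ℝ => x) ν₀) (hν₀_zero : ν₀ {0} = 0) {t : ℝ}
    (ht : t ∈ Icc 0 P.T) : Integrable (fun x => ξ P μ x t) ν₀ := by
  obtain ⟨gX, gξ, -, hgξ, h⟩ := exists_hasLinearGrowth_state hP hμ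
  refine (hgξ.integrable hν₀ t).congr ?_
  filter_upwards [compl_mem_ae_iff.2 hν₀_zero] with x hx using (h x hx t ht).2.symm

/-- Fubini applied to the equation of `ξ`: the indicator averages to the participation rate, and the
mean of `X s` is `∫_s^T F` because `X` is the remaining integral of `ξ`. -/
theorem isPrimitiveOn_F (hP : P.IsAdmissible) (hμ : IntervalIntegrable μ volume 0 P.T)
    (hν₀ : Integrable (fun x : ℝ => x) ν₀) (hν₀_zero : ν₀ {0} = 0) :
    IsPrimitiveOn P.T (F P ν₀ μ)
      (fun s => -meanDrift P (participation P ν₀ μ) μ (F P ν₀ μ) s) := by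
  obtain ⟨gX, gξ, hgX, hgξ, h⟩ := exists_hasLinearGrowth_state hP hμ
  obtain ⟨X₁, Y₁, X₂, Y₂, hF⟩ := exists_isFundamentalSystem hP
  have hT := hP.T_pos.le
  have hT' := uIcc_of_le hT
  have hτ := measurable_τ hP (isPrimitiveOn_f hP hF hμ).continuousOn
  have hne : ∀ᵐ x ∂ν₀, x ≠ 0 := compl_mem_ae_iff.2 hν₀_zero
  have hind : HasLinearGrowth (fun z => if z.2 ≤ τ P μ z.1 then 1 else 0) := by
    refine IsBoundedMeasurable.hasLinearGrowth ⟨Measurable.ite (measurableSet_le measurable_snd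
      (hτ.comp measurable_fst)) measurable_const measurable_const, 1, fun z => ?_⟩
    split_ifs <;> simp
  have hKμ : IntervalIntegrable (fun s => P.κ s / P.η s * μ s) volume 0 P.T :=
    hμ.continuousOn_mul (by rw [hT']; exact hP.continuousOn_κ_div_η)
  have hKc := hP.intervalIntegrable_cost
  have hKη : IntervalIntegrable (fun t => (P.η' t - P.δ * P.κ t) / P.η t) volume 0 P.T :=
    hP.continuousOn_η'_sub_div_η.intervalIntegrable_of_Icc hT
  have hFξ : ∀ s ∈ Icc 0 P.T, F P ν₀ μ s = ∫ x, gξ (x, s) ∂ν₀ := fun s hs =>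
    integral_congr_ae (by filter_upwards [hne] with x hx using (h x hx s hs).2)
  have hpart : ∀ s, participation P ν₀ μ s = ∫ x, (if s ≤ τ P μ x then 1 else 0) ∂ν₀ := fun s => by
    have := integral_indicator_one (μ := ν₀) (hτ measurableSet_Ici : MeasurableSet (τ P μ ⁻¹' Ici s))
    rw [participation]
    exact this.symm
  have hX : ∀ s ∈ Icc 0 P.T, ∫ x, gX (x, s) ∂ν₀ = ∫ u in s..P.T, F P ν₀ μ u := fun s hs => by
    have h1 := hgξ.integral_intervalIntegral hν₀ (a := s) (b := P.T)
      (intervalIntegrable_const (c := (1 : ℝ)))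
    simp only [one_mul] at h1
    have h2 : ∀ u ∈ uIcc s P.T, u ∈ Icc 0 P.T := fun u hu => by
      rw [uIcc_of_le hs.2] at hu
      exact ⟨hs.1.trans hu.1, hu.2⟩
    rw [intervalIntegral.integral_congr fun u hu => hFξ u (h2 u hu), ← h1]
    refine integral_congr_ae ?_
    filter_upwards [hne] with x hx
    rw [← (h x hx s hs).1, state_fst_eq_integral hP hμ hx hs]
    exact intervalIntegral.integral_congr fun u hu => (h x hx u (h2 u hu)).2
  have hdrift : ∀ s ∈ Icc 0 P.T, meanDrift P (participation P ν₀ μ) μ (F P ν₀ μ) s =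
      P.κ s / P.η s * μ s * (∫ x, (if s ≤ τ P μ x then 1 else 0) ∂ν₀) +
      (P.lam s + P.δ * P.κ' s) / P.η s * (∫ x, gX (x, s) ∂ν₀) +
      (P.η' s - P.δ * P.κ s) / P.η s * ∫ x, gξ (x, s) ∂ν₀ := fun s hs => by
    rw [meanDrift, hpart s, hX s hs, hFξ s hs]
  have hmem : ∀ t ∈ Icc 0 P.T, uIcc t P.T ⊆ uIcc 0 P.T := fun t ht => by
    rw [uIcc_of_le ht.2, hT']
    exact Icc_subset_Icc_left ht.1
  have hi1 := hind.intervalIntegrable_integral hν₀ hKμ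
  have hi2 := hgX.intervalIntegrable_integral hν₀ hKc
  have hi3 := hgξ.intervalIntegrable_integral hν₀ hKη
  refine IsPrimitiveOn.of_eq_terminal_add hT
    (((hi1.add hi2).add hi3).congr fun s hs => ?_) fun t ht => ?_
  · rw [uIoc_of_le hT] at hs
    exact (hdrift s (Ioc_subset_Icc_self hs)).symm
  have hsub := hmem t ht
  rw [intervalIntegral.integral_congr fun s hs => hdrift s (by rw [← hT']; exact hsub hs),
    intervalIntegral.integral_add ((hi1.mono_set hsub).add (hi2.mono_set hsub))
      (hi3.mono_set hsub),
    intervalIntegral.integral_add (hi1.mono_set hsub) (hi2.mono_set hsub),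
    ← hind.integral_intervalIntegral hν₀ (hKμ.mono_set hsub),
    ← hgX.integral_intervalIntegral hν₀ (hKc.mono_set hsub),
    ← hgξ.integral_intervalIntegral hν₀ (hKη.mono_set hsub), hFξ P.T hP.T_mem]
  have hj1 := hind.integrable_intervalIntegral hν₀ (hKμ.mono_set hsub)
  have hj2 := hgX.integrable_intervalIntegral hν₀ (hKc.mono_set hsub)
  have hj3 := hgξ.integrable_intervalIntegral hν₀ (hKη.mono_set hsub)
  -- All terms are gathered under a single `ν₀`-integral, so the identity is checked for each `x ≠
  -- 0`.
  rw [← integral_add_add_add (hgξ.integrable hν₀ P.T) hj1 hj2 hj3]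
  refine integral_congr_ae ?_
  filter_upwards [hne] with x hx
  have hk1 := hind.intervalIntegrable_mul (hKμ.mono_set hsub) x
  have hk2 := hgX.intervalIntegrable_mul (hKc.mono_set hsub) x
  have hk3 := hgξ.intervalIntegrable_mul (hKη.mono_set hsub) x
  rw [(isPrimitiveOn_ξ hP hμ hx).eq_terminal_add ht, (h x hx P.T hP.T_mem).2]
  rw [← intervalIntegral.integral_add hk1 hk2, ← intervalIntegral.integral_add (hk1.add hk2) hk3]
  congr 1
  refine intervalIntegral.integral_congr fun s hs => ?_
  have hs' : s ∈ Icc 0 P.T := by rw [← hT']; exact hsub hs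
  simp only [(h x hx s hs').1, (h x hx s hs').2]

end LiquidationGame

/-! ### Constant sign, the participation rate and the equivalence -/

namespace LiquidationGame

variable {P : Coefficients} {μ : ℝ → ℝ} {ν₀ : Measure ℝ} [IsProbabilityMeasure ν₀]

/-- A mean trading rate solving the integral equation with a bounded participation rate has a
constant sign. -/
theorem sign_trichotomy (hP : P.IsAdmissible) {ρ : ℝ → ℝ} {R : ℝ}
    (hρ : ∀ t ∈ Icc 0 P.T, |ρ t| ≤ R)
    (hμ : IsPrimitiveOn P.T μ (fun s => -meanDrift P ρ μ μ s)) :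
    (∀ t ∈ Icc 0 P.T, 0 < μ t) ∨ (∀ t ∈ Icc 0 P.T, μ t < 0) ∨ ∀ t ∈ Icc 0 P.T, μ t = 0 := by
  obtain ⟨B, hB⟩ := isCompact_Icc.exists_bound_of_continuousOn hP.continuousOn_κ_div_η
  obtain ⟨E, hE⟩ := isCompact_Icc.exists_bound_of_continuousOn hP.continuousOn_η'_sub_div_η
  obtain ⟨D, hD⟩ := hP.exists_cost_bound
  have hθ : ∀ᵐ s, s ∈ Icc 0 P.T →
      |P.κ s / P.η s * ρ s + (P.η' s - P.δ * P.κ s) / P.η s| ≤ B * R + E := by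
    refine .of_forall fun s hs => (abs_add_le _ _).trans (add_le_add ?_ (hE s hs))
    rw [abs_mul]
    exact mul_le_mul (hB s hs) (hρ s hs) (abs_nonneg _) ((norm_nonneg _).trans (hB s hs))
  have hd : ∀ᵐ s, s ∈ Icc 0 P.T → 0 ≤ (P.lam s + P.δ * P.κ' s) / P.η s := by
    filter_upwards [hP.ae_cost_nonneg] with s h hs using div_nonneg (h hs) (hP.η_pos s hs).le
  -- With feedback `μ` itself, the participation term joins the bounded zeroth-order coefficient.
  have hq : IsPrimitiveOn P.T μ (fun s =>
      -((P.κ s / P.η s * ρ s + (P.η' s - P.δ * P.κ s) / P.η s) * μ s +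
        (P.lam s + P.δ * P.κ' s) / P.η s * ∫ u in s..P.T, μ u)) :=
    hμ.congr_deriv fun s _ => by rw [meanDrift]; ring
  rcases lt_trichotomy (μ P.T) 0 with h | h | h
  · right; left
    have hq' : IsPrimitiveOn P.T (fun s => -μ s) (fun s =>
        -((P.κ s / P.η s * ρ s + (P.η' s - P.δ * P.κ s) / P.η s) * -μ s +
          (P.lam s + P.δ * P.κ' s) / P.η s * ∫ u in s..P.T, -μ u)) :=
      hq.neg.congr_deriv fun s _ => by rw [intervalIntegral.integral_neg]; ring
    exact fun t ht => neg_pos.1 (hq'.pos_of_terminal_pos hθ hd (neg_pos.2 h) ht)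
  · exact .inr (.inr fun t ht => hq.eq_zero_of_terminal_eq_zero hθ hD h ht)
  · exact .inl fun t ht => hq.pos_of_terminal_pos hθ hd h ht

section Participation

theorem fMax_eq_of_isGreatest {s m : ℝ} (h : IsGreatest (f P μ '' Icc 0 s) m) :
    fMax P μ s = m :=
  h.csSup_eq

theorem fMin_eq_of_isLeast {s m : ℝ} (h : IsLeast (f P μ '' Icc 0 s) m) : fMin P μ s = m :=
  h.csInf_eq

theorem participation_eq_real_compl {ν₀ : Measure ℝ} (hP : P.IsAdmissible)
    (hf : ContinuousOn (f P μ) (Icc 0 P.T)) {s : ℝ} (hs : s ≤ P.T) :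
    participation P ν₀ μ s = ν₀.real (f P μ '' Ico 0 s)ᶜ := by
  rw [participation]
  congr 1
  ext x
  exact le_τ_iff hP hf hs

/-- The image of `[0, s)` is `[0, f s)`, with complement `(-∞, 0) ∪ [f s, ∞)`. Strictness keeps `f
s` out of the image, where `ν₀` may have an atom; at `0` there is none, so `(-∞, 0)` has measure `p₀
0`. -/
theorem participation_eq_of_monotoneOn (hP : P.IsAdmissible) (hν₀_zero : ν₀ {0} = 0)
    (hf : ContinuousOn (f P μ) (Icc 0 P.T)) {s : ℝ} (hs : s ∈ Ioc 0 P.T)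
    (hmono : MonotoneOn (f P μ) (Icc 0 s)) (hlt : ∀ t ∈ Ico 0 s, f P μ t < f P μ s) :
    participation P ν₀ μ s = q₀ ν₀ (fMax P μ s) + p₀ ν₀ (fMin P μ s) := by
  have h0 : (0 : ℝ) ∈ Icc 0 s := ⟨le_rfl, hs.1.le⟩
  have hss : s ∈ Icc 0 s := ⟨hs.1.le, le_rfl⟩
  have hmax : fMax P μ s = f P μ s := fMax_eq_of_isGreatest
    ⟨mem_image_of_mem _ hss, by rintro _ ⟨t, ht, rfl⟩; exact hmono ht hss ht.2⟩
  have hmin : fMin P μ s = 0 := fMin_eq_of_isLeast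
    ⟨⟨0, h0, f_zero P μ⟩, by
      rintro _ ⟨t, ht, rfl⟩
      exact (f_zero P μ).symm.le.trans (hmono h0 ht ht.1)⟩
  have himage : f P μ '' Ico 0 s = Ico 0 (f P μ s) := by
    refine Subset.antisymm ?_ ?_
    · rintro _ ⟨t, ht, rfl⟩
      exact ⟨(f_zero P μ).symm.le.trans (hmono h0 (Ico_subset_Icc_self ht) ht.1), hlt t ht⟩
    · have := intermediate_value_Ico hs.1.le (hf.mono (Icc_subset_Icc_right hs.2))
      rwa [f_zero] at this
  have hpos : 0 < f P μ s := by simpa [f_zero] using hlt 0 ⟨le_rfl, hs.1⟩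
  have hset : (Ico 0 (f P μ s))ᶜ = Ici (f P μ s) ∪ Iio 0 := by
    ext x
    simp only [mem_compl_iff, mem_Ico, not_and, not_lt, mem_union, mem_Ici, mem_Iio]
    grind
  rw [participation_eq_real_compl hP hf hs.2, himage, hset, measureReal_union ?_ measurableSet_Iio,
    hmax, hmin, q₀, p₀]
  · congr 1
    exact measureReal_congr (Iio_ae_eq_Iic' hν₀_zero)
  · exact disjoint_left.2 fun x hx hx' => absurd (hpos.trans_le hx) (not_lt.2 (le_of_lt hx'))

theorem participation_eq_of_antitoneOn (hP : P.IsAdmissible) (hν₀_zero : ν₀ {0} = 0)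
    (hf : ContinuousOn (f P μ) (Icc 0 P.T)) {s : ℝ} (hs : s ∈ Ioc 0 P.T)
    (hanti : AntitoneOn (f P μ) (Icc 0 s)) (hlt : ∀ t ∈ Ico 0 s, f P μ s < f P μ t) :
    participation P ν₀ μ s = q₀ ν₀ (fMax P μ s) + p₀ ν₀ (fMin P μ s) := by
  have h0 : (0 : ℝ) ∈ Icc 0 s := ⟨le_rfl, hs.1.le⟩
  have hss : s ∈ Icc 0 s := ⟨hs.1.le, le_rfl⟩
  have hmin : fMin P μ s = f P μ s := fMin_eq_of_isLeast
    ⟨mem_image_of_mem _ hss, by rintro _ ⟨t, ht, rfl⟩; exact hanti ht hss ht.2⟩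
  have hmax : fMax P μ s = 0 := fMax_eq_of_isGreatest
    ⟨⟨0, h0, f_zero P μ⟩, by
      rintro _ ⟨t, ht, rfl⟩
      exact (hanti h0 ht ht.1).trans (f_zero P μ).le⟩
  have himage : f P μ '' Ico 0 s = Ioc (f P μ s) 0 := by
    refine Subset.antisymm ?_ ?_
    · rintro _ ⟨t, ht, rfl⟩
      exact ⟨hlt t ht, (hanti h0 (Ico_subset_Icc_self ht) ht.1).trans (f_zero P μ).le⟩
    · have := intermediate_value_Ico' hs.1.le (hf.mono (Icc_subset_Icc_right hs.2))
      rwa [f_zero] at this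
  have hneg : f P μ s < 0 := by simpa [f_zero] using hlt 0 ⟨le_rfl, hs.1⟩
  have hset : (Ioc (f P μ s) 0)ᶜ = Ioi 0 ∪ Iic (f P μ s) := by
    ext x
    simp only [mem_compl_iff, mem_Ioc, not_and, not_le, mem_union, mem_Iic, mem_Ioi]
    grind
  rw [participation_eq_real_compl hP hf hs.2, himage, hset, measureReal_union ?_ measurableSet_Iic,
    hmax, hmin, q₀, p₀]
  · congr 1
    exact measureReal_congr (Ioi_ae_eq_Ici' hν₀_zero)
  · exact disjoint_left.2 fun x hx hx' => absurd (hneg.trans_le' hx') (not_lt.2 (le_of_lt hx))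

/-- Along a continuous mean trading rate of constant sign, the participation rate is given by the
running extrema of `f_μ` wherever `κ` does not vanish. -/
theorem κ_mul_participation_eq (hP : P.IsAdmissible) (hν₀_zero : ν₀ {0} = 0)
    (hμc : ContinuousOn μ (Icc 0 P.T))
    (hsign : (∀ t ∈ Icc 0 P.T, 0 < μ t) ∨ (∀ t ∈ Icc 0 P.T, μ t < 0) ∨
      ∀ t ∈ Icc 0 P.T, μ t = 0) {s : ℝ} (hs : s ∈ Ioc 0 P.T) :
    P.κ s * μ s * participation P ν₀ μ s =
      P.κ s * μ s * (q₀ ν₀ (fMax P μ s) + p₀ ν₀ (fMin P μ s)) := by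
  obtain ⟨X₁, Y₁, X₂, Y₂, hF⟩ := exists_isFundamentalSystem hP
  have hμ : IntervalIntegrable μ volume 0 P.T := hμc.intervalIntegrable_of_Icc hP.T_pos.le
  have hf' := isPrimitiveOn_f hP hF hμ
  have hf := hf'.continuousOn
  have hsT := Ioc_subset_Icc_self hs
  have hsub : Icc 0 s ⊆ Icc 0 P.T := Icc_subset_Icc_right hs.2
  -- Where `κ s = 0` both sides vanish, whatever the rates are.
  rcases (hP.κ_nonneg s hsT).eq_or_lt with hκ | hκ
  · rw [← hκ]
    simp
  have hcont : ContinuousOn (fun t => -(P.κ t * μ t * (X₂ t * discount P t))) (Icc 0 P.T) :=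
    ((hP.κ_contDiffOn.continuousOn.mul hμc).mul
      (hF.snd.fst.continuousOn.mul (isPrimitiveOn_discount hP).continuousOn)).neg
  have hX : ∀ t ∈ Icc 0 P.T, 0 ≤ -(X₂ t * discount P t) := fun t ht => by
    rcases ht.1.eq_or_lt with rfl | h0
    · simp [hF.X₂_zero]
    · nlinarith [hF.X₂_neg hP ⟨h0, ht.2⟩, discount_pos P t]
  have hXs : 0 < -(X₂ s * discount P s) := by
    nlinarith [hF.X₂_neg hP hs, discount_pos P s]
  rcases hsign with hsign | hsign | hsign
  · congr 1
    have hnonneg : ∀ t ∈ Icc 0 P.T, 0 ≤ -(P.κ t * μ t * (X₂ t * discount P t)) := fun t ht => by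
      have := mul_nonneg (mul_nonneg (hP.κ_nonneg t ht) (hsign t ht).le) (hX t ht)
      linarith
    -- A positive derivative at the single time `s` suffices: `f` is nondecreasing and must increase
    -- strictly just before `s`, even if `κ` vanishes earlier.
    have hpos : 0 < -(P.κ s * μ s * (X₂ s * discount P s)) := by
      have := mul_pos (mul_pos hκ (hsign s hsT)) hXs
      linarith
    refine participation_eq_of_monotoneOn hP hν₀_zero hf hs (fun t ht r hr htr => ?_)
      fun t ht => ?_
    · have := intervalIntegral.integral_nonneg (μ := volume) htr fun u hu =>
        hnonneg u (hsub ⟨ht.1.trans hu.1, hu.2.trans hr.2⟩)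
      rw [hf'.integral_eq_sub (hsub ht) (hsub hr)] at this
      linarith
    · have := intervalIntegral.integral_pos ht.2 (hcont.mono (Icc_subset_Icc ht.1 hs.2))
        (fun u hu => hnonneg u ⟨ht.1.trans hu.1.le, hu.2.trans hs.2⟩)
        ⟨s, right_mem_Icc.2 ht.2.le, hpos⟩
      rw [hf'.integral_eq_sub (hsub (Ico_subset_Icc_self ht)) hsT] at this
      linarith
  · congr 1
    have hnonpos : ∀ t ∈ Icc 0 P.T, 0 ≤ - -(P.κ t * μ t * (X₂ t * discount P t)) := fun t ht => by
      have := mul_nonneg (mul_nonneg (hP.κ_nonneg t ht) (neg_nonneg.2 (hsign t ht).le)) (hX t ht)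
      linarith
    have hneg : 0 < - -(P.κ s * μ s * (X₂ s * discount P s)) := by
      have := mul_pos (mul_pos hκ (neg_pos.2 (hsign s hsT))) hXs
      linarith
    refine participation_eq_of_antitoneOn hP hν₀_zero hf hs (fun t ht r hr htr => ?_)
      fun t ht => ?_
    · have := intervalIntegral.integral_nonneg (μ := volume) htr fun u hu =>
        hnonpos u (hsub ⟨ht.1.trans hu.1, hu.2.trans hr.2⟩)
      rw [hf'.neg.integral_eq_sub (hsub ht) (hsub hr)] at this
      linarith
    · have hcont' : ContinuousOn (fun t => - -(P.κ t * μ t * (X₂ t * discount P t)))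
          (Icc 0 P.T) := hcont.neg
      have := intervalIntegral.integral_pos ht.2 (hcont'.mono (Icc_subset_Icc ht.1 hs.2))
        (fun u hu => hnonpos u ⟨ht.1.trans hu.1.le, hu.2.trans hs.2⟩)
        ⟨s, right_mem_Icc.2 ht.2.le, hneg⟩
      rw [hf'.neg.integral_eq_sub (hsub (Ico_subset_Icc_self ht)) hsT] at this
      linarith
  · rw [hsign s hsT]
    simp

end Participation

/-- Monotonicity supplies the measurability of the rate, which with boundedness makes the first
integral in the equation genuine. -/
theorem antitoneOn_q₀_fMax_add_p₀_fMin (hf : ContinuousOn (f P μ) (Icc 0 P.T)) :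
    AntitoneOn (fun s => q₀ ν₀ (fMax P μ s) + p₀ ν₀ (fMin P μ s)) (Icc 0 P.T) := by
  intro s hs t ht hst
  have hK : IsCompact (f P μ '' Icc 0 t) :=
    isCompact_Icc.image_of_continuousOn (hf.mono (Icc_subset_Icc_right ht.2))
  have hsub : f P μ '' Icc 0 s ⊆ f P μ '' Icc 0 t := image_mono (Icc_subset_Icc_right hst)
  have hne : (f P μ '' Icc 0 s).Nonempty := ⟨_, 0, ⟨le_rfl, hs.1⟩, rfl⟩
  have hmax : fMax P μ s ≤ fMax P μ t := csSup_le_csSup hK.bddAbove hne hsub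
  have hmin : fMin P μ t ≤ fMin P μ s := csInf_le_csInf hK.bddBelow hne hsub
  exact add_le_add (measureReal_mono (Ici_subset_Ici.2 hmax))
    (measureReal_mono (Iic_subset_Iic.2 hmin))

theorem abs_q₀_add_p₀_le (ν₀ : Measure ℝ) [IsProbabilityMeasure ν₀] (x y : ℝ) :
    |q₀ ν₀ x + p₀ ν₀ y| ≤ 2 := by
  have h1 : q₀ ν₀ x ≤ 1 := measureReal_le_one
  have h2 : p₀ ν₀ y ≤ 1 := measureReal_le_one
  have h3 : 0 ≤ q₀ ν₀ x := measureReal_nonneg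
  have h4 : 0 ≤ p₀ ν₀ y := measureReal_nonneg
  rw [abs_of_nonneg (add_nonneg h3 h4)]
  linarith

theorem solvesIntegralEquation_iff (hP : P.IsAdmissible)
    (hμ : IntervalIntegrable μ volume 0 P.T) :
    SolvesIntegralEquation P ν₀ μ ↔ IsPrimitiveOn P.T μ (fun s =>
      -meanDrift P (fun s => q₀ ν₀ (fMax P μ s) + p₀ ν₀ (fMin P μ s)) μ μ s) := by
  obtain ⟨X₁, Y₁, X₂, Y₂, hF⟩ := exists_isFundamentalSystem hP
  have hT := hP.T_pos.le
  have hT' := uIcc_of_le hT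
  have hf := (isPrimitiveOn_f hP hF hμ).continuousOn
  have hi1 : IntervalIntegrable (fun s => P.κ s / P.η s * μ s *
      (q₀ ν₀ (fMax P μ s) + p₀ ν₀ (fMin P μ s))) volume 0 P.T := by
    have h1 : IntervalIntegrable (fun s => P.κ s / P.η s * μ s) volume 0 P.T :=
      hμ.continuousOn_mul (by rw [hT']; exact hP.continuousOn_κ_div_η)
    rw [intervalIntegrable_iff_integrableOn_Icc_of_le hT] at h1 ⊢
    exact h1.mul_bdd (c := 2) (aemeasurable_restrict_of_antitoneOn measurableSet_Icc
      (antitoneOn_q₀_fMax_add_p₀_fMin hf)).aestronglyMeasurable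
      (.of_forall fun s => abs_q₀_add_p₀_le ν₀ _ _)
  have hi2 : IntervalIntegrable (fun s => (P.lam s + P.δ * P.κ' s) / P.η s *
      ∫ u in s..P.T, μ u) volume 0 P.T := by
    refine hP.intervalIntegrable_cost.mul_continuousOn ?_
    rw [hT']
    have := (IsPrimitiveOn.integral hT hμ)
    refine (continuousOn_const (c := ∫ u in (0 : ℝ)..P.T, μ u)).sub this.continuousOn |>.congr
      fun s hs => this.integral_eq_sub hs hP.T_mem
  have hi3 : IntervalIntegrable (fun s => (P.η' s - P.δ * P.κ s) / P.η s * μ s) volume 0 P.T :=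
    hμ.continuousOn_mul (by rw [hT']; exact hP.continuousOn_η'_sub_div_η)
  have hkey : ∀ t ∈ Icc 0 P.T, μ P.T + (∫ s in t..P.T,
        meanDrift P (fun s => q₀ ν₀ (fMax P μ s) + p₀ ν₀ (fMin P μ s)) μ μ s) =
      μ P.T
      + (∫ s in t..P.T, P.κ s / P.η s * (q₀ ν₀ (fMax P μ s) + p₀ ν₀ (fMin P μ s)) * μ s)
      + (∫ s in t..P.T, (P.lam s + P.δ * P.κ' s) / P.η s * ∫ u in s..P.T, μ u)
      + ∫ s in t..P.T, (P.η' s - P.δ * P.κ s) / P.η s * μ s := fun t ht => by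
    have hsub : uIcc t P.T ⊆ uIcc 0 P.T := by
      rw [uIcc_of_le ht.2, hT']
      exact Icc_subset_Icc_left ht.1
    simp only [meanDrift]
    rw [intervalIntegral.integral_add ((hi1.mono_set hsub).add (hi2.mono_set hsub))
        (hi3.mono_set hsub),
      intervalIntegral.integral_add (hi1.mono_set hsub) (hi2.mono_set hsub),
      intervalIntegral.integral_congr (f := fun s => P.κ s / P.η s *
        (q₀ ν₀ (fMax P μ s) + p₀ ν₀ (fMin P μ s)) * μ s) fun s _ => mul_right_comm _ _ _]
    ring
  constructor
  · exact fun h => .of_eq_terminal_add hT ((hi1.add hi2).add hi3) fun t ht =>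
      (h t ht).trans (hkey t ht).symm
  · exact fun h t ht => (h.eq_terminal_add ht).trans (hkey t ht)

theorem solvesFixedPoint_iff (hP : P.IsAdmissible) (hμ : IntervalIntegrable μ volume 0 P.T)
    (hν₀ : Integrable (fun x : ℝ => x) ν₀) (hν₀_zero : ν₀ {0} = 0) :
    SolvesFixedPoint P ν₀ μ ↔ μ P.T = F P ν₀ μ P.T ∧ SolvesIntegralEquation P ν₀ μ := by
  have hFprim := isPrimitiveOn_F hP hμ hν₀ hν₀_zero
  -- For `μ` of constant sign the two rates define the same drift; the time `0` is left out as a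
  -- null set.
  have hdrift : ContinuousOn μ (Icc 0 P.T) → ((∀ t ∈ Icc 0 P.T, 0 < μ t) ∨
      (∀ t ∈ Icc 0 P.T, μ t < 0) ∨ ∀ t ∈ Icc 0 P.T, μ t = 0) → ∀ q : ℝ → ℝ, ∀ s ∈ Ioc 0 P.T,
      meanDrift P (fun s => q₀ ν₀ (fMax P μ s) + p₀ ν₀ (fMin P μ s)) μ q s =
        meanDrift P (participation P ν₀ μ) μ q s := fun hc hsign q s hs => by
    have h := κ_mul_participation_eq (ν₀ := ν₀) hP hν₀_zero hc hsign hs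
    have hη := hP.η_ne_zero (Ioc_subset_Icc_self hs)
    simp only [meanDrift]
    congr 2
    field_simp
    exact h.symm
  rw [solvesIntegralEquation_iff hP hμ]
  constructor
  · intro h
    have hint : ∀ s ∈ Icc 0 P.T, ∫ u in s..P.T, F P ν₀ μ u = ∫ u in s..P.T, μ u := fun s hs =>
      intervalIntegral.integral_congr fun u hu => by
        rw [uIcc_of_le hs.2] at hu
        exact (h u ⟨hs.1.trans hu.1, hu.2⟩).symm
    -- A fixed point inherits the regularity of `F(μ)`, so the merely integrable `μ` is in fact
    -- continuous.
    have hμprim : IsPrimitiveOn P.T μ (fun s => -meanDrift P (participation P ν₀ μ) μ μ s) :=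
      hFprim.congr h fun s hs => by rw [meanDrift, meanDrift, hint s hs, h s hs]
    have hsign := sign_trichotomy hP (R := 1) (fun t _ => by
      rw [participation, abs_of_nonneg measureReal_nonneg]
      exact measureReal_le_one) hμprim
    refine ⟨h P.T hP.T_mem, hμprim.congr_ae (fun _ _ => rfl) (.of_forall fun s hs => ?_)⟩
    rw [hdrift hμprim.continuousOn hsign μ s hs]
  · rintro ⟨hT, h⟩
    have hsign := sign_trichotomy hP (fun t _ => abs_q₀_add_p₀_le ν₀ _ _) h
    have hμprim : IsPrimitiveOn P.T μ (fun s => -meanDrift P (participation P ν₀ μ) μ μ s) :=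
      h.congr_ae (fun _ _ => rfl) (.of_forall fun s hs => by
        rw [hdrift h.continuousOn hsign μ s hs])
    obtain ⟨E, hE⟩ := isCompact_Icc.exists_bound_of_continuousOn hP.continuousOn_η'_sub_div_η
    obtain ⟨D, hD⟩ := hP.exists_cost_bound
    -- Both equations carry the same feedback `μ` and the same rate, so the `κ` term with the
    -- participation rate cancels in the difference.
    have hG : IsPrimitiveOn P.T (fun t => F P ν₀ μ t - μ t) (fun s =>
        -((P.η' s - P.δ * P.κ s) / P.η s * (F P ν₀ μ s - μ s) +
          (P.lam s + P.δ * P.κ' s) / P.η s * ∫ u in s..P.T, (F P ν₀ μ u - μ u))) := by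
      refine (hFprim.sub hμprim).congr_deriv fun s hs => ?_
      have hsub : Icc s P.T ⊆ Icc 0 P.T := Icc_subset_Icc_left hs.1
      rw [intervalIntegral.integral_sub
        ((hFprim.continuousOn.mono hsub).intervalIntegrable_of_Icc hs.2)
        ((hμprim.continuousOn.mono hsub).intervalIntegrable_of_Icc hs.2), meanDrift, meanDrift]
      ring
    intro t ht
    have := hG.eq_zero_of_terminal_eq_zero (.of_forall fun s hs => hE s hs) hD
      (by rw [hT, sub_self]) ht
    linarith

end LiquidationGame

theorem mainTheorem8 (P : LiquidationGame.Coefficients)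
    (hT : 0 < P.T) (hδ : P.δ ∈ Icc (0 : ℝ) 1)
    (hη : ContDiffOn ℝ 1 P.η (Icc 0 P.T)) (hη_pos : ∀ t ∈ Icc 0 P.T, 0 < P.η t)
    (hκ : ContDiffOn ℝ 1 P.κ (Icc 0 P.T)) (hκ_nonneg : ∀ t ∈ Icc 0 P.T, 0 ≤ P.κ t)
    (hlam : MemLp P.lam ⊤ (volume.restrict (Icc 0 P.T)))
    (hlam_nonneg : ∀ᵐ t ∂(volume.restrict (Icc 0 P.T)), 0 ≤ P.lam t)
    (hlamκ : ∀ᵐ t ∂(volume.restrict (Icc 0 P.T)), 0 ≤ P.lam t + P.δ * P.κ' t)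
    (ν₀ : Measure ℝ) [IsProbabilityMeasure ν₀]
    (hν₀ : Integrable (fun x : ℝ => x) ν₀) (hν₀_zero : ν₀ {0} = 0)
    (μ : ℝ → ℝ) (hμ : IntegrableOn μ (Icc 0 P.T)) :
    (∀ t ∈ Icc 0 P.T, Integrable (fun x => LiquidationGame.ξ P μ x t) ν₀) ∧
    (LiquidationGame.SolvesFixedPoint P ν₀ μ ↔
      μ P.T = LiquidationGame.F P ν₀ μ P.T ∧
        LiquidationGame.SolvesIntegralEquation P ν₀ μ) := by
  have hP : P.IsAdmissible :=
    ⟨hT, hη, hη_pos, hκ, hκ_nonneg, hlam, hlam_nonneg, hlamκ⟩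
  have hμ' : IntervalIntegrable μ volume 0 P.T :=
    (intervalIntegrable_iff_integrableOn_Icc_of_le hT.le).2 hμ
  exact ⟨fun t ht => LiquidationGame.integrable_ξ hP hμ' hν₀ hν₀_zero ht,
    LiquidationGame.solvesFixedPoint_iff hP hμ' hν₀ hν₀_zero⟩
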